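/- Let $L>0$, $\Pi=\{(x,t)\in\mathbb R^2 : 0<x<L,\ t>0\}$. Let $\lambda\in C^1(\overline\Pi)$ with $\lambda>0$ on $\overline\Pi$, $p\in C(\overline\Pi)$, and let $f=f(x,t,y)$ be continuous on $\overline\Pi\times\mathbb R$, continuously differentiable in $y$, with $f$ and $\partial_y f$ bounded on $K\times\mathbb R$ for every compact $K\subset\overline\Pi$. Let $a_r,b_r\in C[0,L]$ and $c_r\in C[0,\infty)$ with $a_r(0)=0$ and $c_r(0)=0$. Let $$a_s=\sum_{i=1}^m\delta_{x_i^*},\qquad b_s=\sum_{i=1}^k\delta_{x_i},\qquad c_s=\sum_{j=1}^l\delta_{t_j}$$ with $0<x_1^*<\dots<x_m^*<L$, $0<x_1<\dots<x_k<L$, $0<t_1<\dots<t_l$. Fix $\varphi\in C_c^\infty(\mathbb R)$ with $\int\varphi\,dx=1$ and $\operatorname{supp}\varphi\subset[-1,1]$, put $\varphi_\varepsilon(x)=\frac1\varepsilon\varphi(\frac x\varepsilon)$ and $a_s^\varepsilon=a_s*\varphi_\varepsilon$, $b_s^\varepsilon=b_s*\varphi_\varepsilon$, $c_s^\varepsilon=c_s*\varphi_\varepsilon$.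 Let $\varepsilon_0>0$ be such that $x_1^*-\varepsilon_0>0$ and $t_1-\varepsilon_0>0$. For a continuous function $u$, $(\partial_t+\lambda\partial_x)u$ at a point $(x,t)\in\Pi$ denotes the derivative of $\tau\mapsto u(\xi(\tau),\tau)$ at $\tau=t$ along the characteristic $\xi'(\tau)=\lambda(\xi(\tau),\tau)$, $\xi(t)=x$. Then for every $0<\varepsilon\le\varepsilon_0$: (i) there is a unique $u^\varepsilon\in C(\overline\Pi)$ such that $$(\partial_t+\lambda\partial_x)u^\varepsilon=p\,u^\varepsilon+f(x,t,u^\varepsilon)\ \text{ in }\Pi,\qquad u^\varepsilon|_{t=0}=a_s^\varepsilon+a_r,\qquad u^\varepsilon|_{x=0}=(c_s^\varepsilon+c_r)\int_0^L(b_s^\varepsilon+b_r)u^\varepsilon\,dx ;$$ (ii) there is a unique pair $(w^\varepsilon,v^\varepsilon)\in C(\overline\Pi)^2$ that solves the coupled system consisting of the nonlinear regular problem $$(\partial_t+\lambda\partial_x)w^\varepsilon=p\,w^\varepsilon+f(x,t,w^\varepsilon)\ \text{ in }\Pi,\qquad w^\varepsilon|_{t=0}=a_r,\qquad w^\varepsilon|_{x=0}=c_r\int_0^L\big[(b_s^\varepsilon+b_r)w^\varepsilon+b_rv^\varepsilon\big]dx$$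 and the linear singular problem $$(\partial_t+\lambda\partial_x)v^\varepsilon=p\,v^\varepsilon\ \text{ in }\Pi,\qquad v^\varepsilon|_{t=0}=a_s^\varepsilon,$$ $$v^\varepsilon|_{x=0}=c_s^\varepsilon\int_0^L\big[(b_s^\varepsilon+b_r)w^\varepsilon+b_rv^\varepsilon\big]dx+c_r\int_0^Lb_s^\varepsilon v^\varepsilon\,dx .$$ Here the initial conditions hold for $0<x<L$ and the boundary conditions for $t>0$. -/

import Mathlib

open Set Filter Topology MeasureTheory
open scoped ContDiff

/-- The half-strip `Π = {(x,t) | 0 < x < L, t > 0}`. -/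
def halfStrip (L : ℝ) : Set (ℝ × ℝ) := {z | 0 < z.1 ∧ z.1 < L ∧ 0 < z.2}

/-- `φ ∈ 𝓓(ℝ)` with `∫ φ = 1` and `supp φ ⊆ [-1,1]`. -/
structure IsMollifier (φ : ℝ → ℝ) : Prop where
  smooth : ContDiff ℝ ∞ φ
  supp : tsupport φ ⊆ Icc (-1) 1
  integral_eq_one : ∫ x, φ x = 1

/-- The model delta net `φ_ε(x) = (1/ε) φ(x/ε)`. -/
noncomputable def deltaNet (φ : ℝ → ℝ) (ε : ℝ) (x : ℝ) : ℝ := (1 / ε) * φ (x / ε)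

/-- The sum of the Dirac delta functions at the points `y 0, …, y (n-1)`. -/
noncomputable def diracSum {n : ℕ} (y : Fin n → ℝ) : Measure ℝ := ∑ i, Measure.dirac (y i)

/-- The regularization `μ ∗ φ_ε` of a singular datum `μ`. -/
noncomputable def regularization (μ : Measure ℝ) (φ : ℝ → ℝ) (ε : ℝ) (x : ℝ) : ℝ :=
  ∫ y, deltaNet φ ε (x - y) ∂μ

/-- `((∂_t + λ ∂_x) u)(x,t) = g` for a function `u` that need only be continuous: `g` is the
derivative of `u` at `(x,t)` along the characteristic `dξ/dτ = λ(ξ,τ)`, `ξ(t) = x`. -/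
def HasTransportDeriv (lam u : ℝ → ℝ → ℝ) (g x t : ℝ) : Prop :=
  ∀ ξ : ℝ → ℝ, ξ t = x → (∀ᶠ τ in 𝓝 t, HasDerivAt ξ (lam (ξ τ) τ) τ) →
    HasDerivAt (fun τ => u (ξ τ) τ) g t

/-- `u` is a continuous solution, on the closure of `Π`, of
`(∂_t + λ ∂_x) u = p u + f(x,t,u)` in `Π`, `u|_{t=0} = a`, `u|_{x=0} = c ∫₀ᴸ b u dx`. -/
structure IsContSolution (L : ℝ) (lam p : ℝ → ℝ → ℝ) (f : ℝ → ℝ → ℝ → ℝ) (a b c : ℝ → ℝ)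
    (u : ℝ → ℝ → ℝ) : Prop where
  cont : ContinuousOn (fun z : ℝ × ℝ => u z.1 z.2) (closure (halfStrip L))
  eqn : ∀ x t, (x, t) ∈ halfStrip L →
    HasTransportDeriv lam u (p x t * u x t + f x t (u x t)) x t
  init : ∀ x ∈ Ioo 0 L, u x 0 = a x
  bdry : ∀ t ∈ Ioi (0 : ℝ), u 0 t = c t * ∫ x in (0 : ℝ)..L, b x * u x t

/-- `(w, v)` is a continuous solution, on the closure of `Π`, of the coupled system formed by
the nonlinear regular problem
`(∂_t + λ ∂_x) w = p w + f(x,t,w)`, `w|_{t=0} = a_r`,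
`w|_{x=0} = c_r ∫₀ᴸ [(b_s + b_r) w + b_r v] dx`
and the linear singular problem
`(∂_t + λ ∂_x) v = p v`, `v|_{t=0} = a_s`,
`v|_{x=0} = c_s ∫₀ᴸ [(b_s + b_r) w + b_r v] dx + c_r ∫₀ᴸ b_s v dx`. -/
structure IsSplitSolution (L : ℝ) (lam p : ℝ → ℝ → ℝ) (f : ℝ → ℝ → ℝ → ℝ)
    (as ar bs br cs cr : ℝ → ℝ) (w v : ℝ → ℝ → ℝ) : Prop where
  cont_w : ContinuousOn (fun z : ℝ × ℝ => w z.1 z.2) (closure (halfStrip L))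
  eqn_w : ∀ x t, (x, t) ∈ halfStrip L →
    HasTransportDeriv lam w (p x t * w x t + f x t (w x t)) x t
  init_w : ∀ x ∈ Ioo 0 L, w x 0 = ar x
  bdry_w : ∀ t ∈ Ioi (0 : ℝ),
    w 0 t = cr t * ∫ x in (0 : ℝ)..L, ((bs x + br x) * w x t + br x * v x t)
  cont_v : ContinuousOn (fun z : ℝ × ℝ => v z.1 z.2) (closure (halfStrip L))
  eqn_v : ∀ x t, (x, t) ∈ halfStrip L → HasTransportDeriv lam v (p x t * v x t) x t
  init_v : ∀ x ∈ Ioo 0 L, v x 0 = as x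
  bdry_v : ∀ t ∈ Ioi (0 : ℝ),
    v 0 t = cs t * (∫ x in (0 : ℝ)..L, ((bs x + br x) * w x t + br x * v x t))
      + cr t * ∫ x in (0 : ℝ)..L, bs x * v x t

/-! Both problems are instances of one semilinear problem with values in a Banach space `E`: `(∂_t +
λ ∂_x) U = F(x, t, U)`, `U|_{t=0} = A`, `U|_{x=0} = C ∫₀ᴸ B U dx`, with operators `B(x)`, `C(t)` on
`E`. Part (i) is `E = ℝ`. Part (ii) is `E = ℝ × ℝ`, where the coupled boundary conditions factor
through two triangular matrices, `splitKernel` under the integral and `splitTrace` outside it.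

On a rectangle `[0, L] × [0, T]` the data are extended to the plane by projection. The extended
speed is Lipschitz in `x` and bounded between positive constants, so characteristics are global and
each crosses `x = 0` exactly once, at a time `Z`. Solving the problem then means being a fixed point
of `transportOp`. Since `A 0 = 0` and `C 0 = 0`, the extended `A` and `C` vanish for nonpositive
arguments. Hence the initial and the boundary datum can simply be added, and the sum is continuous
across the characteristic through the origin.

The operator halves distances in the weight `exp (N t - M x)` (`exists_weight_contraction`). A large
`M` makes the nonlocal boundary integral small, and `N` large compared with `M Λ` makes the source
integral small. This works for every `T` with no subdivision of time. Uniqueness on rectangles lets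
the solutions be glued as `T → ∞`.

The bound on `∂_y f` makes `F` Lipschitz. The condition `ε ≤ ε₀` keeps the mollified deltas away
from the corner, which gives `A 0 = 0` and `C 0 = 0`. -/

open scoped NNReal

/-! ### Global characteristics -/

section Transport

variable {E : Type*} [NormedAddCommGroup E] [NormedSpace ℝ E]

/-- A speed on the whole plane, uniformly Lipschitz in space and bounded between two positive
constants. -/
structure IsUniformSpeed (v : ℝ → ℝ → ℝ) (K : ℝ≥0) (μ Λ : ℝ) : Prop where
  lip : ∀ t, LipschitzWith K (fun x => v x t)
  cont : Continuous (fun z : ℝ × ℝ => v z.1 z.2)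
  pos : 0 < μ
  lower : ∀ x t, μ ≤ v x t
  upper : ∀ x t, v x t ≤ Λ

/-- `X τ (x, t)` is the position at time `τ` of the characteristic through `(x, t)`, and `Z (x, t)`
is the time at which this characteristic crosses the line `x = 0`. -/
structure IsCharFlow (v : ℝ → ℝ → ℝ) (μ Λ : ℝ) (X : ℝ → ℝ × ℝ → ℝ) (Z : ℝ × ℝ → ℝ) : Prop where
  self : ∀ z, X z.2 z = z.1
  deriv : ∀ z τ, HasDerivAt (fun s => X s z) (v (X τ z) τ) τ
  cont : Continuous (fun q : ℝ × (ℝ × ℝ) => X q.1 q.2)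
  zero : ∀ z, X (Z z) z = 0
  cont_zero : Continuous Z
  comp : ∀ σ τ z, X σ (X τ z, τ) = X σ z
  lower : ∀ z s t, s ≤ t → μ * (t - s) ≤ X t z - X s z
  upper : ∀ z s t, s ≤ t → X t z - X s z ≤ Λ * (t - s)
  pos : 0 < μ
  unique : ∀ (ξ : ℝ → ℝ) (t : ℝ), (∀ᶠ τ in 𝓝 t, HasDerivAt ξ (v (ξ τ) τ) τ) →
    ∀ᶠ τ in 𝓝 t, ξ τ = X τ (ξ t, t)

namespace IsUniformSpeed

variable {v : ℝ → ℝ → ℝ} {K : ℝ≥0} {μ Λ : ℝ}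

theorem exists_solution_Ioo (h : IsUniformSpeed v K μ Λ) (x t : ℝ) {N : ℝ} (hN : 0 < N) :
    ∃ α : ℝ → ℝ, α t = x ∧ ∀ τ ∈ Ioo (t - N) (t + N), HasDerivAt α (v (α τ) τ) τ := by
  have hΛ : 0 < Λ := h.pos.trans_le ((h.lower 0 0).trans (h.upper 0 0))
  -- The speed is bounded by `Λ` everywhere, so a ball of radius `Λ N` contains the curve for the
  -- whole time `N` and the interval need not shrink.
  have hpl : IsPicardLindelof (fun τ y => v y τ) (tmin := t - N) (tmax := t + N)
      ⟨t, by constructor <;> linarith⟩ x (Λ.toNNReal * N.toNNReal) 0 Λ.toNNReal K := by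
    refine ⟨fun τ _ => (h.lip τ).lipschitzOnWith, fun y _ => ?_, fun τ _ y _ => ?_, ?_⟩
    · exact (h.cont.comp (by fun_prop : Continuous fun τ : ℝ => (y, τ))).continuousOn
    · rw [Real.coe_toNNReal _ hΛ.le, Real.norm_of_nonneg (h.pos.le.trans (h.lower _ _))]
      exact h.upper _ _
    · simp [hΛ.le, hN.le]
  obtain ⟨α, h0, hα⟩ := hpl.exists_eq_forall_mem_Icc_hasDerivWithinAt₀
  exact ⟨α, h0, fun τ hτ => (hα τ (Ioo_subset_Icc_self hτ)).hasDerivAt (Icc_mem_nhds hτ.1 hτ.2)⟩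

theorem exists_solution (h : IsUniformSpeed v K μ Λ) (x t : ℝ) :
    ∃ α : ℝ → ℝ, α t = x ∧ ∀ τ, HasDerivAt α (v (α τ) τ) τ := by
  have hpos (r : ℝ) : 0 < |r - t| + 1 := by positivity
  choose α h0 hα using fun r : ℝ => h.exists_solution_Ioo x t (hpos r)
  have key (r s τ : ℝ) (hr : |τ - t| < |r - t| + 1) (hs : |τ - t| < |s - t| + 1) :
      α r τ = α s τ := by
    have hsub (q : ℝ) (hq : min (|r - t| + 1) (|s - t| + 1) ≤ |q - t| + 1) (σ : ℝ)
        (hσ : σ ∈ Ioo (t - min (|r - t| + 1) (|s - t| + 1))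
          (t + min (|r - t| + 1) (|s - t| + 1))) : HasDerivAt (α q) (v (α q σ) σ) σ :=
      hα q σ ⟨by linarith [hσ.1], by linarith [hσ.2]⟩
    have hm : |τ - t| < min (|r - t| + 1) (|s - t| + 1) := lt_min hr hs
    have h0m : 0 < min (|r - t| + 1) (|s - t| + 1) := lt_min (hpos r) (hpos s)
    refine ODE_solution_unique_of_mem_Ioo (v := fun τ y => v y τ) (s := fun _ => univ) (t₀ := t)
      (fun τ _ => (h.lip τ).lipschitzOnWith) ⟨by linarith, by linarith⟩
      (fun σ hσ => ⟨hsub r (min_le_left _ _) σ hσ, trivial⟩)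
      (fun σ hσ => ⟨hsub s (min_le_right _ _) σ hσ, trivial⟩) (by rw [h0, h0]) ?_
    rw [abs_lt] at hm
    exact ⟨by linarith, by linarith⟩
  -- The value at `τ` is read off the local solution whose window has radius `|τ - t| + 1`; by
  -- `key`, neighbouring windows give the same curve.
  refine ⟨fun τ => α τ τ, h0 t, fun τ => ?_⟩
  have hτ := hα τ τ (by
    have := neg_abs_le (τ - t); have := le_abs_self (τ - t)
    constructor <;> linarith)
  refine hτ.congr_of_eventuallyEq ?_
  have hc : Continuous fun s : ℝ => |s - t| := by fun_prop
  filter_upwards [hc.continuousAt.eventually (gt_mem_nhds (lt_add_one |τ - t|))] with s hs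
  exact key s τ s (lt_add_one _) hs

/-- Grönwall's inequality in both time directions; the backward case follows by reversing time. -/
theorem abs_sub_le_exp (h : IsUniformSpeed v K μ Λ) {α β : ℝ → ℝ}
    (hα : ∀ τ, HasDerivAt α (v (α τ) τ) τ) (hβ : ∀ τ, HasDerivAt β (v (β τ) τ) τ) (s t : ℝ) :
    |α t - β t| ≤ |α s - β s| * Real.exp (K * |t - s|) := by
  have hcα : Continuous α := continuous_iff_continuousAt.2 fun τ => (hα τ).continuousAt
  have hcβ : Continuous β := continuous_iff_continuousAt.2 fun τ => (hβ τ).continuousAt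
  rcases le_total s t with hst | hst
  · have := dist_le_of_trajectories_ODE (v := fun τ y => v y τ) (fun τ => h.lip τ)
      hcα.continuousOn (fun τ _ => (hα τ).hasDerivWithinAt) hcβ.continuousOn
      (fun τ _ => (hβ τ).hasDerivWithinAt) (le_refl (dist (α s) (β s))) t ⟨hst, le_rfl⟩
    rwa [Real.dist_eq, Real.dist_eq, ← abs_of_nonneg (sub_nonneg.2 hst)] at this
  · have hrev {γ : ℝ → ℝ} (hγ : ∀ τ, HasDerivAt γ (v (γ τ) τ) τ) (τ : ℝ) :
        HasDerivAt (fun τ => γ (-τ)) (-v (γ (-τ)) (-τ)) τ := by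
      have := (hγ (-τ)).comp τ (hasDerivAt_neg τ)
      rwa [mul_neg_one] at this
    have := dist_le_of_trajectories_ODE (v := fun τ y => -v y (-τ)) (a := -s) (b := -t)
      (fun τ => (h.lip (-τ)).neg)
      (hcα.comp continuous_neg).continuousOn (fun τ _ => (hrev hα τ).hasDerivWithinAt)
      (hcβ.comp continuous_neg).continuousOn (fun τ _ => (hrev hβ τ).hasDerivWithinAt)
      (le_refl _) (-t) ⟨neg_le_neg hst, le_rfl⟩
    simp only [Function.comp_apply, neg_neg, Real.dist_eq] at this
    rwa [show -t - -s = |t - s| by rw [abs_of_nonpos (sub_nonpos.2 hst)]; ring] at this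

theorem exists_charFlow (h : IsUniformSpeed v K μ Λ) : ∃ X Z, IsCharFlow v μ Λ X Z := by
  choose Y hself hder using fun z : ℝ × ℝ => h.exists_solution z.1 z.2
  have hderiv (z : ℝ × ℝ) (τ : ℝ) : deriv (Y z) τ = v (Y z τ) τ := (hder z τ).deriv
  have hdiff (z : ℝ × ℝ) : Differentiable ℝ (Y z) := fun τ => (hder z τ).differentiableAt
  have hlower (z : ℝ × ℝ) (s t : ℝ) (hst : s ≤ t) : μ * (t - s) ≤ Y z t - Y z s :=
    mul_sub_le_image_sub_of_le_deriv (hdiff z) (fun τ => by rw [hderiv]; exact h.lower _ _) hst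
  have hupper (z : ℝ × ℝ) (s t : ℝ) (hst : s ≤ t) : Y z t - Y z s ≤ Λ * (t - s) :=
    image_sub_le_mul_sub_of_deriv_le (hdiff z) (fun τ => by rw [hderiv]; exact h.upper _ _) hst
  have hμ := h.pos
  have hΛ : 0 < Λ := h.pos.trans_le ((h.lower 0 0).trans (h.upper 0 0))
  have habs (z : ℝ × ℝ) (s t : ℝ) : |Y z t - Y z s| ≤ Λ * |t - s| := by
    rcases le_total s t with hst | hst
    · rw [abs_of_nonneg (sub_nonneg.2 hst), abs_of_nonneg]
      · exact hupper z s t hst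
      · nlinarith [hlower z s t hst]
    · rw [abs_sub_comm, abs_sub_comm t s, abs_of_nonneg (sub_nonneg.2 hst), abs_of_nonneg]
      · exact hupper z t s hst
      · nlinarith [hlower z t s hst]
  have hcont : Continuous (fun q : ℝ × (ℝ × ℝ) => Y q.2 q.1) := by
    rw [continuous_iff_continuousAt]
    rintro ⟨τ, z⟩
    rw [ContinuousAt, tendsto_iff_dist_tendsto_zero]
    -- The two curves are compared at the common time `z.2`: the curve through `z'` moves by at most
    -- `Λ |z.2 - z'.2|` to get there, and Grönwall carries the gap to time `τ`.
    have hb : ∀ q : ℝ × (ℝ × ℝ), dist (Y q.2 q.1) (Y z τ) ≤ Λ * |q.1 - τ| +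
        (|q.2.1 - z.1| + Λ * |z.2 - q.2.2|) * Real.exp (K * |τ - z.2|) := by
      rintro ⟨τ', z'⟩
      have h1 := habs z' τ τ'
      have h2 := h.abs_sub_le_exp (hder z') (hder z) z.2 τ
      have h3 := habs z' z'.2 z.2
      rw [hself] at h2 h3
      have h4 : |Y z' z.2 - z.1| ≤ |z'.1 - z.1| + Λ * |z.2 - z'.2| := by
        have := abs_add_le (Y z' z.2 - z'.1) (z'.1 - z.1)
        rw [sub_add_sub_cancel] at this
        linarith
      have h5 := mul_le_mul_of_nonneg_right h4 (Real.exp_pos (K * |τ - z.2|)).le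
      have h6 := abs_add_le (Y z' τ' - Y z' τ) (Y z' τ - Y z τ)
      rw [sub_add_sub_cancel] at h6
      rw [Real.dist_eq]
      dsimp only
      linarith
    refine squeeze_zero (fun _ => dist_nonneg) hb ?_
    have hc : Continuous fun q : ℝ × (ℝ × ℝ) => Λ * |q.1 - τ| +
        (|q.2.1 - z.1| + Λ * |z.2 - q.2.2|) * Real.exp (K * |τ - z.2|) := by fun_prop
    simpa using hc.tendsto (τ, z)
  have hzero (z : ℝ × ℝ) : ∃ τ, Y z τ = 0 := by
    refine mem_range_of_exists_le_of_exists_ge (hdiff z).continuous ?_ ?_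
    · refine ⟨-(|Y z 0| / μ), ?_⟩
      have h1 := hlower z (-(|Y z 0| / μ)) 0 (by simp; positivity)
      have h2 := le_abs_self (Y z 0)
      have h3 : μ * (0 - -(|Y z 0| / μ)) = |Y z 0| := by field_simp; ring
      linarith
    · refine ⟨|Y z 0| / μ, ?_⟩
      have h1 := hlower z 0 (|Y z 0| / μ) (by positivity)
      have h2 := neg_abs_le (Y z 0)
      have h3 : μ * (|Y z 0| / μ - 0) = |Y z 0| := by field_simp; ring
      linarith
  choose Z hZ using hzero
  refine ⟨fun τ z => Y z τ, Z, hself, hder, hcont, hZ, ?_, ?_, hlower, hupper, hμ, ?_⟩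
  · rw [continuous_iff_continuousAt]
    intro z
    rw [ContinuousAt, tendsto_iff_dist_tendsto_zero]
    -- At time `Z z` the curve through `z'` is at distance `|Y z' (Z z)|` from `x = 0`, and it moves
    -- with speed at least `μ`.
    have hb : ∀ z', dist (Z z') (Z z) ≤ |Y z' (Z z)| / μ := by
      intro z'
      rw [le_div_iff₀ hμ, Real.dist_eq]
      rcases le_total (Z z) (Z z') with hle | hle
      · have h1 := hlower z' _ _ hle
        rw [hZ] at h1
        rw [abs_of_nonneg (sub_nonneg.2 hle)]
        linarith [neg_abs_le (Y z' (Z z))]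
      · have h1 := hlower z' _ _ hle
        rw [hZ] at h1
        rw [abs_of_nonpos (sub_nonpos.2 hle)]
        linarith [le_abs_self (Y z' (Z z))]
    refine squeeze_zero (fun _ => dist_nonneg) hb ?_
    have hc : Continuous fun z' => |Y z' (Z z)| / μ :=
      ((hcont.comp (by fun_prop : Continuous fun z' : ℝ × ℝ => (Z z, z'))).abs).div_const _
    simpa [hZ] using hc.tendsto z
  · intro σ τ z
    have := ODE_solution_unique_univ (v := fun τ y => v y τ) (s := fun _ => univ) (t₀ := τ)
      (f := Y (Y z τ, τ)) (g := Y z) (fun τ => (h.lip τ).lipschitzOnWith)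
      (fun s => ⟨hder _ s, trivial⟩) (fun s => ⟨hder _ s, trivial⟩) (hself (Y z τ, τ))
    exact congrFun this σ
  · intro ξ t hξ
    exact ODE_solution_unique_of_eventually (v := fun τ y => v y τ) (s := fun _ => univ)
      (Eventually.of_forall fun τ => (h.lip τ).lipschitzOnWith)
      (hξ.mono fun s hs => ⟨hs, trivial⟩) (Eventually.of_forall fun s => ⟨hder _ s, trivial⟩)
      (hself (ξ t, t)).symm

end IsUniformSpeed

/-! ### The integral operator along characteristics -/

/-- Globally defined data of a semilinear transport problem in `[0, L] × [0, T]`, with initial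
datum `A` and boundary operator `C(t) ∫₀ᴸ B(s) u(s, t) ds`, both of which vanish for nonpositive
arguments. -/
structure IsUniformData (F : ℝ → ℝ → E → E) (A : ℝ → E) (B C : ℝ → E →L[ℝ] E)
    (k β γ : ℝ) : Prop where
  cont_F : Continuous (fun q : (ℝ × ℝ) × E => F q.1.1 q.1.2 q.2)
  lip_F : ∀ x t y z, ‖F x t y - F x t z‖ ≤ k * ‖y - z‖
  cont_A : Continuous A
  cont_B : Continuous B
  cont_C : Continuous C
  norm_B : ∀ x, ‖B x‖ ≤ β
  norm_C : ∀ t, ‖C t‖ ≤ γ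
  A_nonpos : ∀ x ≤ 0, A x = 0
  C_nonpos : ∀ t ≤ 0, C t = 0

/-- The integral operator along characteristics whose fixed points solve the transport problem. -/
noncomputable def transportOp (L : ℝ) (F : ℝ → ℝ → E → E) (A : ℝ → E) (B C : ℝ → E →L[ℝ] E)
    (X : ℝ → ℝ × ℝ → ℝ) (Z : ℝ × ℝ → ℝ) (V : ℝ × ℝ → E) (z : ℝ × ℝ) : E :=
  A (X 0 z) + C (Z z) (∫ s in (0 : ℝ)..L, B s (V (s, Z z))) +
    ∫ τ in (max 0 (Z z))..z.2, F (X τ z) τ (V (X τ z, τ))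

theorem integral_exp_mul_add {c : ℝ} (hc : c ≠ 0) (d a b : ℝ) :
    ∫ s in a..b, Real.exp (c * s + d) = (Real.exp (c * b + d) - Real.exp (c * a + d)) / c := by
  have hder : ∀ s ∈ uIcc a b,
      HasDerivAt (fun s => Real.exp (c * s + d) / c) (Real.exp (c * s + d)) s := by
    intro s _
    have h1 : HasDerivAt (fun s => c * s + d) c s := by
      simpa using ((hasDerivAt_id s).const_mul c).add_const d
    simpa [hc] using h1.exp.div_const c
  rw [intervalIntegral.integral_eq_sub_of_hasDerivAt hder
    (Continuous.intervalIntegrable (by fun_prop) _ _)]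
  ring

namespace IsCharFlow

variable {v : ℝ → ℝ → ℝ} {μ Λ : ℝ} {X : ℝ → ℝ × ℝ → ℝ} {Z : ℝ × ℝ → ℝ}

theorem strictMono (h : IsCharFlow v μ Λ X Z) (z : ℝ × ℝ) : StrictMono (fun τ => X τ z) := by
  intro s t hst
  have := h.lower z s t hst.le
  have := mul_pos h.pos (sub_pos.2 hst)
  linarith

theorem eq_zero_iff (h : IsCharFlow v μ Λ X Z) {z : ℝ × ℝ} {τ : ℝ} : X τ z = 0 ↔ τ = Z z :=
  ⟨fun hτ => (h.strictMono z).injective (hτ.trans (h.zero z).symm), fun hτ => hτ ▸ h.zero z⟩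

theorem nonneg_iff (h : IsCharFlow v μ Λ X Z) {z : ℝ × ℝ} {τ : ℝ} : 0 ≤ X τ z ↔ Z z ≤ τ := by
  rw [← h.zero z]
  exact (h.strictMono z).le_iff_le

theorem pos_iff (h : IsCharFlow v μ Λ X Z) {z : ℝ × ℝ} {τ : ℝ} : 0 < X τ z ↔ Z z < τ := by
  rw [← h.zero z]
  exact (h.strictMono z).lt_iff_lt

theorem zero_comp (h : IsCharFlow v μ Λ X Z) (τ : ℝ) (z : ℝ × ℝ) : Z (X τ z, τ) = Z z := by
  rw [← h.eq_zero_iff, ← h.comp _ τ z, h.zero]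

theorem zero_le_time (h : IsCharFlow v μ Λ X Z) {z : ℝ × ℝ} (hz : 0 ≤ z.1) : Z z ≤ z.2 := by
  rwa [← h.nonneg_iff, h.self]

/-- Characteristics increase, so between the entry time `max 0 (Z z)` and `z.2` the curve stays
right of `x = 0` and left of `z.1`. -/
theorem mem_rect (h : IsCharFlow v μ Λ X Z) {L T : ℝ} {z : ℝ × ℝ}
    (hz : z ∈ Icc 0 L ×ˢ Icc 0 T) {τ : ℝ} (hτ : τ ∈ Icc (max 0 (Z z)) z.2) :
    (X τ z, τ) ∈ Icc 0 L ×ˢ Icc 0 T := by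
  obtain ⟨⟨_, hx⟩, _, ht⟩ := hz
  have h1 := (h.strictMono z).monotone hτ.2
  rw [h.self] at h1
  exact ⟨⟨h.nonneg_iff.2 ((le_max_right _ _).trans hτ.1), h1.trans hx⟩,
    (le_max_left _ _).trans hτ.1, hτ.2.trans ht⟩

end IsCharFlow

/-! ### Contraction in an exponential weight and the fixed point -/

section Operator

variable {v : ℝ → ℝ → ℝ} {μ Λ L T k β γ : ℝ} {X : ℝ → ℝ × ℝ → ℝ} {Z : ℝ × ℝ → ℝ}
  {F : ℝ → ℝ → E → E} {A : ℝ → E} {B C : ℝ → E →L[ℝ] E}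

theorem continuous_transportOp (h : IsCharFlow v μ Λ X Z) (hd : IsUniformData F A B C k β γ)
    {V : ℝ × ℝ → E} (hV : Continuous V) : Continuous (transportOp L F A B C X Z V) := by
  have hX := h.cont
  have hZ := h.cont_zero
  have hA := hd.cont_A
  have hB := hd.cont_B
  have hC := hd.cont_C
  have hF' : Continuous (fun q : (ℝ × ℝ) × ℝ => F (X q.2 q.1) q.2 (V (X q.2 q.1, q.2))) := by
    have hX' : Continuous (fun q : (ℝ × ℝ) × ℝ => X q.2 q.1) :=
      hX.comp (by fun_prop : Continuous fun q : (ℝ × ℝ) × ℝ => (q.2, q.1))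
    exact hd.cont_F.comp (by fun_prop :
      Continuous fun q : (ℝ × ℝ) × ℝ => ((X q.2 q.1, q.2), V (X q.2 q.1, q.2)))
  have hX0 : Continuous fun z => X 0 z :=
    hX.comp (by fun_prop : Continuous fun z : ℝ × ℝ => ((0 : ℝ), z))
  have h1 : Continuous fun z : ℝ × ℝ => ∫ s in (0 : ℝ)..L, B s (V (s, Z z)) :=
    intervalIntegral.continuous_parametric_intervalIntegral_of_continuous'
      (f := fun (z : ℝ × ℝ) s => B s (V (s, Z z)))
      (by simp only [Function.uncurry_def]; fun_prop) 0 L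
  have h2 (e : ℝ × ℝ → ℝ) (he : Continuous e) : Continuous fun z : ℝ × ℝ =>
      ∫ τ in (0 : ℝ)..e z, F (X τ z) τ (V (X τ z, τ)) :=
    intervalIntegral.continuous_parametric_intervalIntegral_of_continuous
      (f := fun (z : ℝ × ℝ) τ => F (X τ z) τ (V (X τ z, τ))) hF' he
  have h3 : Continuous fun z : ℝ × ℝ =>
      ∫ τ in (max 0 (Z z))..z.2, F (X τ z) τ (V (X τ z, τ)) := by
    have hi (z : ℝ × ℝ) (a b : ℝ) :
        IntervalIntegrable (fun τ => F (X τ z) τ (V (X τ z, τ))) volume a b :=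
      (hF'.comp (by fun_prop : Continuous fun τ : ℝ => (z, τ))).intervalIntegrable a b
    have := (h2 (fun z => z.2) continuous_snd).sub (h2 (fun z => max 0 (Z z)) (by fun_prop))
    refine this.congr fun z => ?_
    exact intervalIntegral.integral_interval_sub_left (hi z _ _) (hi z _ _)
  unfold transportOp
  fun_prop

theorem continuous_integrand (h : IsCharFlow v μ Λ X Z) (hd : IsUniformData F A B C k β γ)
    {V : ℝ × ℝ → E} (hV : Continuous V) (z : ℝ × ℝ) :
    Continuous fun τ => F (X τ z) τ (V (X τ z, τ)) := by
  have hX' : Continuous (fun τ => X τ z) :=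
    h.cont.comp (by fun_prop : Continuous fun τ : ℝ => (τ, z))
  exact hd.cont_F.comp (by fun_prop : Continuous fun τ => ((X τ z, τ), V (X τ z, τ)))

/-- The exponential weight in which the integral operator along characteristics contracts. -/
noncomputable def expWeight (N M : ℝ) (z : ℝ × ℝ) : ℝ := Real.exp (N * z.2 - M * z.1)

theorem expWeight_pos (N M : ℝ) (z : ℝ × ℝ) : 0 < expWeight N M z := Real.exp_pos _

/-- The factor `1 / M` comes from `∫₀ᴸ exp (-M s) ds ≤ 1 / M`. The remaining `exp (N * Z z)` is at
most the weight at `z`, because `z.1 ≤ Λ (z.2 - Z z)` and `M Λ ≤ N`. -/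
theorem norm_boundary_sub_le (h : IsCharFlow v μ Λ X Z) (hd : IsUniformData F A B C k β γ)
    (hL : 0 ≤ L) {V W : ℝ × ℝ → E} (hV : Continuous V) (hW : Continuous W) {N M δ : ℝ}
    (hM : 0 < M) (hN : M * Λ ≤ N) (hδ : 0 ≤ δ)
    (hVW : ∀ z ∈ Icc 0 L ×ˢ Icc 0 T, ‖V z - W z‖ ≤ δ * expWeight N M z)
    {z : ℝ × ℝ} (hz : z ∈ Icc 0 L ×ˢ Icc 0 T) :
    ‖C (Z z) (∫ s in (0 : ℝ)..L, B s (V (s, Z z))) -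
      C (Z z) (∫ s in (0 : ℝ)..L, B s (W (s, Z z)))‖ ≤ γ * β / M * (δ * expWeight N M z) := by
  have hβ : 0 ≤ β := (norm_nonneg _).trans (hd.norm_B 0)
  have hγ : 0 ≤ γ := (norm_nonneg _).trans (hd.norm_C 0)
  have hB := hd.cont_B
  have hω := expWeight_pos N M z
  rcases le_or_gt (Z z) 0 with h0 | h0
  · simp only [hd.C_nonpos _ h0, zero_apply, sub_self, norm_zero]
    positivity
  have ht := h.zero_le_time hz.1.1
  rw [← map_sub, ← intervalIntegral.integral_sub
    (Continuous.intervalIntegrable (by fun_prop) _ _)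
    (Continuous.intervalIntegrable (by fun_prop) _ _)]
  have hint : ‖∫ s in (0 : ℝ)..L, (B s (V (s, Z z)) - B s (W (s, Z z)))‖ ≤
      ∫ s in (0 : ℝ)..L, β * (δ * Real.exp ((-M) * s + N * Z z)) := by
    refine intervalIntegral.norm_integral_le_of_norm_le hL (Eventually.of_forall fun s hs => ?_)
      (Continuous.intervalIntegrable (by fun_prop) _ _)
    rw [← map_sub]
    refine ((B s).le_opNorm _).trans (mul_le_mul (hd.norm_B s) ?_ (norm_nonneg _) hβ)
    refine (hVW (s, Z z) ⟨⟨hs.1.le, hs.2⟩, h0.le, ht.trans hz.2.2⟩).trans (le_of_eq ?_)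
    rw [expWeight]
    congr 2
    ring
  have hexp : Real.exp (N * Z z) ≤ expWeight N M z := by
    refine Real.exp_le_exp.2 ?_
    have h1 := h.upper z _ _ ht
    rw [h.self, h.zero] at h1
    have h2 := mul_le_mul_of_nonneg_left h1 hM.le
    have h3 := mul_le_mul_of_nonneg_right hN (sub_nonneg.2 ht)
    linarith
  have hint' : ∫ s in (0 : ℝ)..L, β * (δ * Real.exp ((-M) * s + N * Z z)) ≤
      β * (δ * (expWeight N M z / M)) := by
    simp only [intervalIntegral.integral_const_mul]
    refine mul_le_mul_of_nonneg_left (mul_le_mul_of_nonneg_left ?_ hδ) hβ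
    rw [integral_exp_mul_add (neg_ne_zero.2 hM.ne'), div_neg, ← neg_div, neg_sub]
    refine div_le_div_of_nonneg_right ?_ hM.le
    rw [mul_zero, zero_add]
    linarith [Real.exp_pos (-M * L + N * Z z)]
  calc _ ≤ γ * (β * (δ * (expWeight N M z / M))) :=
        ((C (Z z)).le_opNorm _).trans
          (mul_le_mul (hd.norm_C _) (hint.trans hint') (norm_nonneg _) hγ)
    _ = _ := by ring

/-- Along a characteristic the logarithm of the weight grows at rate at least `N - M Λ`, so
integrating the weight up to `z` costs at most a factor `1 / (N - M Λ)`. -/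
theorem norm_source_sub_le (h : IsCharFlow v μ Λ X Z) (hd : IsUniformData F A B C k β γ)
    {V W : ℝ × ℝ → E} (hV : Continuous V) (hW : Continuous W) {N M δ : ℝ}
    (hM : 0 < M) (hN : M * Λ < N) (hδ : 0 ≤ δ) (hk : 0 ≤ k)
    (hVW : ∀ z ∈ Icc 0 L ×ˢ Icc 0 T, ‖V z - W z‖ ≤ δ * expWeight N M z)
    {z : ℝ × ℝ} (hz : z ∈ Icc 0 L ×ˢ Icc 0 T) :
    ‖(∫ τ in (max 0 (Z z))..z.2, F (X τ z) τ (V (X τ z, τ))) -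
      ∫ τ in (max 0 (Z z))..z.2, F (X τ z) τ (W (X τ z, τ))‖ ≤
      k / (N - M * Λ) * (δ * expWeight N M z) := by
  have hν : 0 < N - M * Λ := sub_pos.2 hN
  have he : max 0 (Z z) ≤ z.2 := max_le hz.2.1 (h.zero_le_time hz.1.1)
  rw [← intervalIntegral.integral_sub ((continuous_integrand h hd hV z).intervalIntegrable _ _)
    ((continuous_integrand h hd hW z).intervalIntegrable _ _)]
  have hint : ‖∫ τ in (max 0 (Z z))..z.2,
      (F (X τ z) τ (V (X τ z, τ)) - F (X τ z) τ (W (X τ z, τ)))‖ ≤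
      ∫ τ in (max 0 (Z z))..z.2, k * (δ * (expWeight N M z *
        Real.exp ((N - M * Λ) * τ + -((N - M * Λ) * z.2)))) := by
    refine intervalIntegral.norm_integral_le_of_norm_le he (Eventually.of_forall fun τ hτ => ?_)
      (Continuous.intervalIntegrable (by fun_prop) _ _)
    have hτ' := Ioc_subset_Icc_self hτ
    refine (hd.lip_F _ _ _ _).trans (mul_le_mul_of_nonneg_left ?_ hk)
    refine (hVW _ (h.mem_rect hz hτ')).trans (mul_le_mul_of_nonneg_left ?_ hδ)
    rw [expWeight, expWeight, ← Real.exp_add]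
    refine Real.exp_le_exp.2 ?_
    have h1 := h.upper z _ _ hτ.2
    rw [h.self] at h1
    have h2 := mul_le_mul_of_nonneg_left h1 hM.le
    dsimp only
    linarith
  refine hint.trans ?_
  simp only [intervalIntegral.integral_const_mul]
  rw [integral_exp_mul_add hν.ne', add_neg_cancel, Real.exp_zero]
  have hω := expWeight_pos N M z
  have : (1 - Real.exp ((N - M * Λ) * max 0 (Z z) + -((N - M * Λ) * z.2))) / (N - M * Λ) ≤
      1 / (N - M * Λ) :=
    div_le_div_of_nonneg_right (sub_le_self _ (Real.exp_pos _).le) hν.le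
  calc _ ≤ k * (δ * (expWeight N M z * (1 / (N - M * Λ)))) := by gcongr
    _ = _ := by ring

theorem exists_weight_contraction (h : IsCharFlow v μ Λ X Z) (hd : IsUniformData F A B C k β γ)
    (hL : 0 ≤ L) (hk : 0 ≤ k) : ∃ N M : ℝ, ∀ V W : ℝ × ℝ → E, Continuous V → Continuous W →
      ∀ δ, 0 ≤ δ → (∀ z ∈ Icc 0 L ×ˢ Icc 0 T, ‖V z - W z‖ ≤ δ * expWeight N M z) →
      ∀ z ∈ Icc 0 L ×ˢ Icc 0 T, ‖transportOp L F A B C X Z V z - transportOp L F A B C X Z W z‖ ≤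
        δ / 2 * expWeight N M z := by
  have hβ : 0 ≤ β := (norm_nonneg _).trans (hd.norm_B 0)
  have hγ : 0 ≤ γ := (norm_nonneg _).trans (hd.norm_C 0)
  -- `M` and `N` make the boundary and source factors at most `1 / 4` each.
  set M := 4 * (γ * β) + 1 with hMdef
  have hM : 0 < M := by positivity
  refine ⟨M * Λ + (4 * k + 1), M, fun V W hV hW δ hδ hVW z hz => ?_⟩
  set N := M * Λ + (4 * k + 1) with hNdef
  have hN : M * Λ < N := by linarith
  have hω := expWeight_pos N M z
  have h1 := norm_boundary_sub_le h hd hL hV hW hM hN.le hδ hVW hz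
  have h2 := norm_source_sub_le h hd hV hW hM hN hδ hk hVW hz
  have h3 : γ * β / M ≤ 1 / 4 := by
    rw [div_le_iff₀ hM]
    linarith
  have h4 : k / (N - M * Λ) ≤ 1 / 4 := by
    rw [hNdef, add_sub_cancel_left, div_le_iff₀ (by positivity)]
    linarith
  have hδω : 0 ≤ δ * expWeight N M z := by positivity
  have h5 := mul_le_mul_of_nonneg_right h3 hδω
  have h6 := mul_le_mul_of_nonneg_right h4 hδω
  have h7 : transportOp L F A B C X Z V z - transportOp L F A B C X Z W z =
      (C (Z z) (∫ s in (0 : ℝ)..L, B s (V (s, Z z))) -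
        C (Z z) (∫ s in (0 : ℝ)..L, B s (W (s, Z z)))) +
      ((∫ τ in (max 0 (Z z))..z.2, F (X τ z) τ (V (X τ z, τ))) -
        ∫ τ in (max 0 (Z z))..z.2, F (X τ z) τ (W (X τ z, τ))) := by
    unfold transportOp
    abel
  rw [h7]
  refine (norm_add_le _ _).trans ?_
  linarith

/-- Times `Z z ≤ 0` lie outside the rectangle, but there `C` vanishes. This lets functions
continuous only on the rectangle be replaced by their compositions with `rectProj`. -/
theorem transportOp_congr (h : IsCharFlow v μ Λ X Z) (hd : IsUniformData F A B C k β γ)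
    (hL : 0 ≤ L) {V W : ℝ × ℝ → E} (hVW : EqOn V W (Icc 0 L ×ˢ Icc 0 T)) :
    EqOn (transportOp L F A B C X Z V) (transportOp L F A B C X Z W) (Icc 0 L ×ˢ Icc 0 T) := by
  intro z hz
  have he : max 0 (Z z) ≤ z.2 := max_le hz.2.1 (h.zero_le_time hz.1.1)
  have h1 : C (Z z) (∫ s in (0 : ℝ)..L, B s (V (s, Z z))) =
      C (Z z) (∫ s in (0 : ℝ)..L, B s (W (s, Z z))) := by
    rcases le_or_gt (Z z) 0 with h0 | h0
    · simp [hd.C_nonpos _ h0]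
    · congr 1
      refine intervalIntegral.integral_congr fun s hs => ?_
      rw [uIcc_of_le hL] at hs
      rw [hVW (x := (s, Z z)) ⟨hs, h0.le, (h.zero_le_time hz.1.1).trans hz.2.2⟩]
  have h2 : ∫ τ in (max 0 (Z z))..z.2, F (X τ z) τ (V (X τ z, τ)) =
      ∫ τ in (max 0 (Z z))..z.2, F (X τ z) τ (W (X τ z, τ)) := by
    refine intervalIntegral.integral_congr fun τ hτ => ?_
    rw [uIcc_of_le he] at hτ
    rw [hVW (h.mem_rect hz hτ)]
  rw [transportOp, transportOp, h1, h2]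

/-- The projection of the plane onto the rectangle `[0, L] × [0, T]`. -/
noncomputable def rectProj (L T : ℝ) (z : ℝ × ℝ) : ℝ × ℝ :=
  (max 0 (min L z.1), max 0 (min T z.2))

theorem continuous_rectProj (L T : ℝ) : Continuous (rectProj L T) := by
  unfold rectProj
  fun_prop

theorem rectProj_mem (hL : 0 ≤ L) (hT : 0 ≤ T) (z : ℝ × ℝ) :
    rectProj L T z ∈ Icc 0 L ×ˢ Icc 0 T :=
  ⟨⟨le_max_left _ _, max_le hL (min_le_left _ _)⟩, le_max_left _ _, max_le hT (min_le_left _ _)⟩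

theorem rectProj_of_mem {z : ℝ × ℝ} (hz : z ∈ Icc 0 L ×ˢ Icc 0 T) : rectProj L T z = z := by
  obtain ⟨⟨h1, h2⟩, h3, h4⟩ := hz
  rw [rectProj, min_eq_right h2, min_eq_right h4, max_eq_right h1, max_eq_right h3]

theorem continuous_comp_rectProj {Y : Type*} [TopologicalSpace Y] (hL : 0 ≤ L) (hT : 0 ≤ T)
    {V : ℝ × ℝ → Y} (hV : ContinuousOn V (Icc 0 L ×ˢ Icc 0 T)) :
    Continuous (fun z => V (rectProj L T z)) :=
  hV.comp_continuous (continuous_rectProj L T) (rectProj_mem hL hT)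

/-- The weighted distance attains its maximum `δ` on the compact rectangle, and the contraction at
that point gives `δ ≤ δ / 2`. -/
theorem eqOn_of_transportOp_fixed (h : IsCharFlow v μ Λ X Z) (hd : IsUniformData F A B C k β γ)
    (hL : 0 ≤ L) (hT : 0 ≤ T) (hk : 0 ≤ k) {V W : ℝ × ℝ → E}
    (hV : ContinuousOn V (Icc 0 L ×ˢ Icc 0 T)) (hW : ContinuousOn W (Icc 0 L ×ˢ Icc 0 T))
    (hV' : EqOn (transportOp L F A B C X Z V) V (Icc 0 L ×ˢ Icc 0 T))
    (hW' : EqOn (transportOp L F A B C X Z W) W (Icc 0 L ×ˢ Icc 0 T)) :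
    EqOn V W (Icc 0 L ×ˢ Icc 0 T) := by
  obtain ⟨N, M, hNM⟩ := exists_weight_contraction (T := T) h hd hL hk
  have hc : ContinuousOn (fun z => ‖V z - W z‖ / expWeight N M z) (Icc 0 L ×ˢ Icc 0 T) := by
    refine (hV.sub hW).norm.div (Continuous.continuousOn ?_) fun z _ => (expWeight_pos N M z).ne'
    unfold expWeight
    fun_prop
  obtain ⟨z₀, hz₀, hmax⟩ := (isCompact_Icc.prod isCompact_Icc).exists_isMaxOn
    (⟨(0, 0), ⟨⟨le_rfl, hL⟩, ⟨le_rfl, hT⟩⟩⟩ : (Icc 0 L ×ˢ Icc 0 T).Nonempty) hc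
  set δ := ‖V z₀ - W z₀‖ / expWeight N M z₀ with hδ
  have hδ0 : 0 ≤ δ := div_nonneg (norm_nonneg _) (expWeight_pos N M z₀).le
  have hle : ∀ z ∈ Icc 0 L ×ˢ Icc 0 T, ‖V z - W z‖ ≤ δ * expWeight N M z := fun z hz =>
    (div_le_iff₀ (expWeight_pos N M z)).1 (hmax hz)
  have hext {U : ℝ × ℝ → E} : EqOn (fun z => U (rectProj L T z)) U (Icc 0 L ×ˢ Icc 0 T) :=
    fun z hz => congrArg U (rectProj_of_mem hz)
  have hhalf := hNM _ _ (continuous_comp_rectProj hL hT hV) (continuous_comp_rectProj hL hT hW) δ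
    hδ0 (fun z hz => by rw [rectProj_of_mem hz]; exact hle z hz) z₀ hz₀
  rw [transportOp_congr h hd hL hext hz₀, transportOp_congr h hd hL hext hz₀, hV' hz₀, hW' hz₀,
    ← div_le_iff₀ (expWeight_pos N M z₀), ← hδ] at hhalf
  have hδz : δ = 0 := by linarith
  intro z hz
  have := hle z hz
  rw [hδz, zero_mul] at this
  exact sub_eq_zero.1 (norm_le_zero_iff.1 this)

theorem exists_transportOp_fixed [CompleteSpace E] (h : IsCharFlow v μ Λ X Z)
    (hd : IsUniformData F A B C k β γ) (hL : 0 ≤ L) (hT : 0 ≤ T) (hk : 0 ≤ k) :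
    ∃ V : ℝ × ℝ → E, Continuous V ∧
      EqOn (transportOp L F A B C X Z V) V (Icc 0 L ×ˢ Icc 0 T) := by
  obtain ⟨N, M, hNM⟩ := exists_weight_contraction (T := T) h hd hL hk
  have hωc : Continuous (expWeight N M) := by unfold expWeight; fun_prop
  have hω (z : ℝ × ℝ) := expWeight_pos N M z
  let D : Set (ℝ × ℝ) := Icc 0 L ×ˢ Icc 0 T
  have : CompactSpace D := isCompact_iff_compactSpace.1 (isCompact_Icc.prod isCompact_Icc)
  let π : ℝ × ℝ → D := fun z => ⟨rectProj L T z, rectProj_mem hL hT z⟩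
  have hπ : Continuous π := (continuous_rectProj L T).subtype_mk _
  have hπD (z : D) : π z = z := Subtype.ext (rectProj_of_mem z.2)
  -- Writing `V` as weight times `g` turns the weighted norm into the sup norm of `C(D, E)`, where
  -- Banach's theorem applies.
  let ext : C(D, E) → ℝ × ℝ → E := fun g z => expWeight N M z • g (π z)
  have hext (g : C(D, E)) : Continuous (ext g) := hωc.smul (g.continuous.comp hπ)
  let Φ : C(D, E) → C(D, E) := fun g =>
    ⟨fun z => (expWeight N M z)⁻¹ • transportOp L F A B C X Z (ext g) z,
      ((hωc.inv₀ fun z => (hω z).ne').smul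
        (continuous_transportOp h hd (hext g))).comp continuous_subtype_val⟩
  have hΦ : ContractingWith (1 / 2) Φ := by
    refine ⟨by norm_num, LipschitzWith.of_dist_le_mul fun g₁ g₂ => ?_⟩
    rw [ContinuousMap.dist_le (by positivity)]
    intro z
    have hle := hNM (ext g₁) (ext g₂) (hext g₁) (hext g₂) (dist g₁ g₂) dist_nonneg
      (fun y _ => by
        rw [← smul_sub, norm_smul, Real.norm_of_nonneg (hω y).le, mul_comm, ← dist_eq_norm]
        exact mul_le_mul_of_nonneg_right (ContinuousMap.dist_apply_le_dist _) (hω y).le) z z.2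
    change dist ((expWeight N M z)⁻¹ • transportOp L F A B C X Z (ext g₁) z)
      ((expWeight N M z)⁻¹ • transportOp L F A B C X Z (ext g₂) z) ≤ _
    rw [dist_eq_norm, ← smul_sub, norm_smul, norm_inv, Real.norm_of_nonneg (hω _).le,
      inv_mul_le_iff₀ (hω _)]
    refine hle.trans (le_of_eq ?_)
    push_cast
    ring
  refine ⟨ext (hΦ.fixedPoint Φ), hext _, fun z hz => ?_⟩
  have hfix : Φ (hΦ.fixedPoint Φ) = hΦ.fixedPoint Φ := hΦ.fixedPoint_isFixedPt
  have hz' : (expWeight N M z)⁻¹ • transportOp L F A B C X Z (ext (hΦ.fixedPoint Φ)) z =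
      hΦ.fixedPoint Φ ⟨z, hz⟩ := DFunLike.congr_fun hfix ⟨z, hz⟩
  change _ = expWeight N M z • hΦ.fixedPoint Φ (π z)
  rw [hπD ⟨z, hz⟩, ← hz', smul_inv_smul₀ (hω z).ne']

end Operator

/-! ### Solutions on a rectangle -/

/-- `U` is a continuous solution in `[0, L] × [0, T]` of `(∂_t + λ ∂_x) U = F(x, t, U)`,
`U|_{t=0} = A`, `U|_{x=0} = C ∫₀ᴸ B U dx`. -/
structure IsRectSolution (L T : ℝ) (lam : ℝ → ℝ → ℝ) (F : ℝ → ℝ → E → E) (A : ℝ → E)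
    (B C : ℝ → E →L[ℝ] E) (U : ℝ → ℝ → E) : Prop where
  cont : ContinuousOn (fun z : ℝ × ℝ => U z.1 z.2) (Icc 0 L ×ˢ Icc 0 T)
  eqn : ∀ x ∈ Ioo 0 L, ∀ t ∈ Ioo 0 T, ∀ ξ : ℝ → ℝ, ξ t = x →
    (∀ᶠ τ in 𝓝 t, HasDerivAt ξ (lam (ξ τ) τ) τ) →
    HasDerivAt (fun τ => U (ξ τ) τ) (F x t (U x t)) t
  init : ∀ x ∈ Ioo 0 L, U x 0 = A x
  bdry : ∀ t ∈ Ioc 0 T, U 0 t = C t (∫ s in (0 : ℝ)..L, B s (U s t))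

namespace IsRectSolution

variable {L T : ℝ} {lam lam' : ℝ → ℝ → ℝ} {F F' : ℝ → ℝ → E → E} {A A' : ℝ → E}
  {B B' C C' : ℝ → E →L[ℝ] E} {U : ℝ → ℝ → E}

theorem mono (h : IsRectSolution L T lam F A B C U) {S : ℝ} (hS : S ≤ T) :
    IsRectSolution L S lam F A B C U where
  cont := h.cont.mono (prod_mono le_rfl (Icc_subset_Icc_right hS))
  eqn x hx t ht := h.eqn x hx t ⟨ht.1, ht.2.trans_le hS⟩
  init := h.init
  bdry t ht := h.bdry t ⟨ht.1, ht.2.trans hS⟩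

/-- Near an interior point a characteristic stays inside the rectangle, so it is a characteristic of
either speed. This exchanges the original data with their extensions to the plane. -/
theorem congr_data (h : IsRectSolution L T lam F A B C U) (hL : 0 ≤ L)
    (hlam : ∀ x ∈ Icc 0 L, ∀ t ∈ Icc 0 T, lam' x t = lam x t)
    (hF : ∀ x ∈ Icc 0 L, ∀ t ∈ Icc 0 T, F' x t = F x t)
    (hA : EqOn A' A (Icc 0 L)) (hB : EqOn B' B (Icc 0 L)) (hC : EqOn C' C (Icc 0 T)) :
    IsRectSolution L T lam' F' A' B' C' U where
  cont := h.cont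
  eqn x hx t ht ξ hξ hder := by
    rw [hF x (Ioo_subset_Icc_self hx) t (Ioo_subset_Icc_self ht)]
    refine h.eqn x hx t ht ξ hξ ?_
    have hc : ContinuousAt ξ t := hder.self_of_nhds.continuousAt
    have hmem : ∀ᶠ τ in 𝓝 t, ξ τ ∈ Ioo 0 L :=
      hc.eventually (Ioo_mem_nhds (hξ ▸ hx.1) (hξ ▸ hx.2))
    filter_upwards [hder, hmem, Ioo_mem_nhds ht.1 ht.2] with τ h1 h2 h3
    rwa [hlam _ (Ioo_subset_Icc_self h2) _ (Ioo_subset_Icc_self h3)] at h1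
  init x hx := by rw [hA (Ioo_subset_Icc_self hx), h.init x hx]
  bdry t ht := by
    rw [hC (Ioc_subset_Icc_self ht), h.bdry t ht]
    congr 1
    refine intervalIntegral.integral_congr fun s hs => ?_
    rw [uIcc_of_le hL] at hs
    rw [hB hs]

theorem congr_sol (h : IsRectSolution L T lam F A B C U) (hL : 0 ≤ L) (hT : 0 ≤ T)
    {W : ℝ → ℝ → E} (hW : ∀ x ∈ Icc 0 L, ∀ t ∈ Icc 0 T, W x t = U x t) :
    IsRectSolution L T lam F A B C W where
  cont := h.cont.congr fun z hz => hW _ hz.1 _ hz.2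
  eqn x hx t ht ξ hξ hder := by
    rw [hW x (Ioo_subset_Icc_self hx) t (Ioo_subset_Icc_self ht)]
    refine (h.eqn x hx t ht ξ hξ hder).congr_of_eventuallyEq ?_
    have hc : ContinuousAt ξ t := hder.self_of_nhds.continuousAt
    have hmem : ∀ᶠ τ in 𝓝 t, ξ τ ∈ Ioo 0 L :=
      hc.eventually (Ioo_mem_nhds (hξ ▸ hx.1) (hξ ▸ hx.2))
    filter_upwards [hmem, Ioo_mem_nhds ht.1 ht.2] with τ h2 h3
    exact hW _ (Ioo_subset_Icc_self h2) _ (Ioo_subset_Icc_self h3)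
  init x hx := by rw [hW x (Ioo_subset_Icc_self hx) 0 ⟨le_rfl, hT⟩, h.init x hx]
  bdry t ht := by
    rw [hW 0 ⟨le_rfl, hL⟩ t (Ioc_subset_Icc_self ht), h.bdry t ht]
    congr 1
    refine intervalIntegral.integral_congr fun s hs => ?_
    rw [uIcc_of_le hL] at hs
    rw [hW s hs t (Ioc_subset_Icc_self ht)]

/-- The endpoints follow by continuity; they matter for characteristics that enter at a corner. -/
theorem init_Icc (h : IsRectSolution L T lam F A B C U) (hL : 0 < L) (hT : 0 ≤ T)
    (hA : Continuous A) {x : ℝ} (hx : x ∈ Icc 0 L) : U x 0 = A x := by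
  have hc : ContinuousOn (fun x => U x 0) (Icc 0 L) :=
    h.cont.comp (by fun_prop : Continuous fun x : ℝ => (x, (0 : ℝ))).continuousOn
      fun x hx => ⟨hx, le_rfl, hT⟩
  have : EqOn (fun x => U x 0) A (Ioo 0 L) := h.init
  exact this.of_subset_closure hc hA.continuousOn Ioo_subset_Icc_self
    (closure_Ioo hL.ne).ge hx

end IsRectSolution

/-! ### Solutions are the fixed points of the integral operator -/

section Equivalence

variable {v : ℝ → ℝ → ℝ} {μ Λ L T k β γ : ℝ} {X : ℝ → ℝ × ℝ → ℝ} {Z : ℝ × ℝ → ℝ}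
  {F : ℝ → ℝ → E → E} {A : ℝ → E} {B C : ℝ → E →L[ℝ] E}

theorem IsCharFlow.eventually_hasDerivAt_speed (h : IsCharFlow v μ Λ X Z) (z : ℝ × ℝ) (t : ℝ) :
    ∀ᶠ τ in 𝓝 t, HasDerivAt (fun s => X s z) (v (X τ z) τ) τ :=
  Eventually.of_forall (h.deriv z)

theorem isRectSolution_of_transportOp_fixed [CompleteSpace E] (h : IsCharFlow v μ Λ X Z)
    (hd : IsUniformData F A B C k β γ) (hL : 0 ≤ L) (hT : 0 ≤ T) {V : ℝ × ℝ → E}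
    (hV : Continuous V) (hfix : EqOn (transportOp L F A B C X Z V) V (Icc 0 L ×ˢ Icc 0 T)) :
    IsRectSolution L T v F A B C (fun x t => V (x, t)) where
  cont := hV.continuousOn
  eqn := by
    rintro x hx t ht ξ rfl hξ
    set z : ℝ × ℝ := (ξ t, t)
    have hmem : ∀ᶠ τ in 𝓝 t, X τ z ∈ Ioo 0 L := by
      have hc : ContinuousAt (fun τ => X τ z) t := (h.deriv z t).continuousAt
      have hz : X t z = ξ t := h.self z
      exact hc.eventually (Ioo_mem_nhds (hx.1.trans_eq hz.symm) (hz.trans_lt hx.2))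
    -- The crossing time and both data terms are constant along the characteristic, so only the
    -- upper limit of the source integral varies.
    have hev : (fun τ => V (ξ τ, τ)) =ᶠ[𝓝 t] fun τ =>
        (A (X 0 z) + C (Z z) (∫ s in (0 : ℝ)..L, B s (V (s, Z z)))) +
          ∫ σ in (max 0 (Z z))..τ, F (X σ z) σ (V (X σ z, σ)) := by
      filter_upwards [h.unique ξ t hξ, hmem, Ioo_mem_nhds ht.1 ht.2] with τ h1 h2 h3
      rw [h1, ← hfix (x := (X τ z, τ)) ⟨Ioo_subset_Icc_self h2, Ioo_subset_Icc_self h3⟩,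
        transportOp]
      simp only [h.comp, h.zero_comp]
    have hc := continuous_integrand h hd hV z
    have hder := (intervalIntegral.integral_hasDerivAt_right (hc.intervalIntegrable
      (max 0 (Z z)) t) hc.stronglyMeasurable.stronglyMeasurableAtFilter hc.continuousAt).const_add
        (A (X 0 z) + C (Z z) (∫ s in (0 : ℝ)..L, B s (V (s, Z z))))
    have hz : X t z = ξ t := h.self z
    rw [hz] at hder
    exact hder.congr_of_eventuallyEq hev
  init x hx := by
    have hz : Z (x, 0) ≤ 0 := h.zero_le_time (z := (x, 0)) hx.1.le
    have hs : X 0 (x, 0) = x := h.self (x, 0)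
    rw [← hfix (x := (x, 0)) ⟨Ioo_subset_Icc_self hx, le_rfl, hT⟩, transportOp, max_eq_left hz,
      hd.C_nonpos _ hz, hs]
    simp
  bdry t ht := by
    have hs : X t (0, t) = 0 := h.self (0, t)
    have hz : t = Z (0, t) := h.eq_zero_iff.1 hs
    have h0 : X 0 (0, t) ≤ 0 := ((h.strictMono (0, t)).monotone ht.1.le).trans_eq hs
    rw [← hfix (x := (0, t)) ⟨⟨le_rfl, hL⟩, Ioc_subset_Icc_self ht⟩, transportOp, ← hz,
      hd.A_nonpos _ h0, max_eq_right ht.1.le, intervalIntegral.integral_same]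
    simp

theorem IsRectSolution.transportOp_fixed [CompleteSpace E] {U : ℝ → ℝ → E}
    (hU : IsRectSolution L T v F A B C U)
    (h : IsCharFlow v μ Λ X Z) (hd : IsUniformData F A B C k β γ) (hL : 0 < L) (hT : 0 ≤ T) :
    EqOn (transportOp L F A B C X Z fun z => U z.1 z.2) (fun z => U z.1 z.2)
      (Icc 0 L ×ˢ Icc 0 T) := by
  intro z hz
  have hZt := h.zero_le_time hz.1.1
  have he : max 0 (Z z) ≤ z.2 := max_le hz.2.1 hZt
  have hXc : Continuous fun τ => X τ z :=
    continuous_iff_continuousAt.2 fun τ => (h.deriv z τ).continuousAt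
  have hcU : ContinuousOn (fun τ => U (X τ z) τ) (Icc (max 0 (Z z)) z.2) :=
    hU.cont.comp (hXc.prodMk continuous_id).continuousOn fun τ hτ => h.mem_rect hz hτ
  have hder : ∀ τ ∈ Ioo (max 0 (Z z)) z.2,
      HasDerivAt (fun τ => U (X τ z) τ) (F (X τ z) τ (U (X τ z) τ)) τ := by
    intro τ hτ
    have h1 : X τ z < L := by
      have := h.strictMono z hτ.2
      dsimp only at this
      rw [h.self] at this
      exact this.trans_le hz.1.2
    exact hU.eqn _ ⟨h.pos_iff.2 ((le_max_right _ _).trans_lt hτ.1), h1⟩ τ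
      ⟨(le_max_left _ _).trans_lt hτ.1, hτ.2.trans_le hz.2.2⟩ _ rfl
      (h.eventually_hasDerivAt_speed z τ)
  have hcF : ContinuousOn (fun τ => F (X τ z) τ (U (X τ z) τ)) (Icc (max 0 (Z z)) z.2) :=
    hd.cont_F.comp_continuousOn ((hXc.prodMk continuous_id).continuousOn.prodMk hcU)
  have hint := intervalIntegral.integral_eq_sub_of_hasDerivAt_of_le he hcU hder
    (hcF.intervalIntegrable_of_Icc he)
  -- For either sign of `Z z` one of the two terms vanishes; the other is the value of `U` where the
  -- characteristic enters the rectangle.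
  have hdatum : A (X 0 z) + C (Z z) (∫ s in (0 : ℝ)..L, B s (U s (Z z))) =
      U (X (max 0 (Z z)) z) (max 0 (Z z)) := by
    rcases le_or_gt (Z z) 0 with h0 | h0
    · have hmem := (h.mem_rect hz (τ := 0) ⟨by rw [max_eq_left h0], hz.2.1⟩).1
      rw [max_eq_left h0, hU.init_Icc hL hT hd.cont_A hmem, hd.C_nonpos _ h0]
      simp
    · have hX0 : X 0 z ≤ 0 := ((h.strictMono z).monotone h0.le).trans_eq (h.zero z)
      rw [max_eq_right h0.le, h.zero, hU.bdry _ ⟨h0, hZt.trans hz.2.2⟩, hd.A_nonpos _ hX0,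
        zero_add]
  rw [transportOp]
  dsimp only
  rw [hdatum, hint, h.self, add_sub_cancel]

end Equivalence

theorem exists_unique_isRectSolution_of_uniform [CompleteSpace E] {v : ℝ → ℝ → ℝ} {K : ℝ≥0}
    {μ Λ L T k β γ : ℝ} {F : ℝ → ℝ → E → E} {A : ℝ → E} {B C : ℝ → E →L[ℝ] E}
    (hv : IsUniformSpeed v K μ Λ) (hd : IsUniformData F A B C k β γ) (hk : 0 ≤ k)
    (hL : 0 < L) (hT : 0 ≤ T) :
    ∃ U, IsRectSolution L T v F A B C U ∧ ∀ U', IsRectSolution L T v F A B C U' →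
      ∀ x ∈ Icc 0 L, ∀ t ∈ Icc 0 T, U' x t = U x t := by
  obtain ⟨X, Z, h⟩ := hv.exists_charFlow
  obtain ⟨V, hV, hfix⟩ := exists_transportOp_fixed h hd hL.le hT hk
  refine ⟨_, isRectSolution_of_transportOp_fixed h hd hL.le hT hV hfix, fun U' hU' x hx t ht => ?_⟩
  exact eqOn_of_transportOp_fixed h hd hL.le hT hk hU'.cont hV.continuousOn
    (hU'.transportOp_fixed h hd hL hT) hfix (x := (x, t)) ⟨hx, ht⟩

theorem closure_halfStrip {L : ℝ} (hL : 0 < L) : closure (halfStrip L) = Icc 0 L ×ˢ Ici 0 := by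
  have : halfStrip L = Ioo 0 L ×ˢ Ioi 0 := by
    ext z
    simp [halfStrip, and_assoc]
  rw [this, closure_prod_eq, closure_Ioo hL.ne, closure_Ioi]

theorem rect_subset_strip (L T : ℝ) :
    Icc (0 : ℝ) L ×ˢ Icc (0 : ℝ) T ⊆ Icc (0 : ℝ) L ×ˢ Ici (0 : ℝ) :=
  prod_mono le_rfl Icc_subset_Ici_self

theorem exists_isUniformSpeed {L T : ℝ} {lam : ℝ → ℝ → ℝ} (hL : 0 ≤ L) (hT : 0 ≤ T)
    (hlam : ContDiffOn ℝ 1 (fun z : ℝ × ℝ => lam z.1 z.2) (Icc 0 L ×ˢ Icc 0 T))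
    (hpos : ∀ x ∈ Icc 0 L, ∀ t ∈ Icc 0 T, 0 < lam x t) :
    ∃ K μ Λ, IsUniformSpeed
      (fun x t => lam (rectProj L T (x, t)).1 (rectProj L T (x, t)).2) K μ Λ := by
  have hcpt : IsCompact (Icc 0 L ×ˢ Icc 0 T) := isCompact_Icc.prod isCompact_Icc
  have hne : (Icc 0 L ×ˢ Icc 0 T).Nonempty := ⟨(0, 0), ⟨le_rfl, hL⟩, ⟨le_rfl, hT⟩⟩
  obtain ⟨K, hK⟩ := hlam.exists_lipschitzOnWith one_ne_zero
    ((convex_Icc 0 L).prod (convex_Icc 0 T)) hcpt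
  obtain ⟨a, ha, hmin⟩ := hcpt.exists_isMinOn hne hlam.continuousOn
  obtain ⟨b, hb, hmax⟩ := hcpt.exists_isMaxOn hne hlam.continuousOn
  refine ⟨K, lam a.1 a.2, lam b.1 b.2, fun t => LipschitzWith.of_dist_le_mul fun x y => ?_,
    continuous_comp_rectProj hL hT hlam.continuousOn, hpos _ ha.1 _ ha.2,
    fun x t => hmin (rectProj_mem hL hT (x, t)), fun x t => hmax (rectProj_mem hL hT (x, t))⟩
  refine (hK.dist_le_mul _ (rectProj_mem hL hT (x, t)) _ (rectProj_mem hL hT (y, t))).trans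
    (mul_le_mul_of_nonneg_left ?_ K.2)
  have h1 := ((LipschitzWith.id.const_min L).const_max 0).dist_le_mul x y
  simpa [Prod.dist_eq, rectProj] using h1

/-! ### From rectangles to the half-strip -/

/-- Conditions on the data of a semilinear transport problem in `[0, L] × [0, ∞)`. -/
structure IsStripData (L : ℝ) (lam : ℝ → ℝ → ℝ) (F : ℝ → ℝ → E → E) (A : ℝ → E)
    (B C : ℝ → E →L[ℝ] E) : Prop where
  speed : ContDiffOn ℝ 1 (fun z : ℝ × ℝ => lam z.1 z.2) (Icc 0 L ×ˢ Ici 0)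
  speed_pos : ∀ x ∈ Icc 0 L, ∀ t ∈ Ici (0 : ℝ), 0 < lam x t
  cont_F : ContinuousOn (fun q : (ℝ × ℝ) × E => F q.1.1 q.1.2 q.2) ((Icc 0 L ×ˢ Ici 0) ×ˢ univ)
  lip_F : ∀ T, ∃ k, 0 ≤ k ∧ ∀ x ∈ Icc 0 L, ∀ t ∈ Icc 0 T, ∀ y z,
    ‖F x t y - F x t z‖ ≤ k * ‖y - z‖
  cont_A : ContinuousOn A (Icc 0 L)
  cont_B : ContinuousOn B (Icc 0 L)
  cont_C : ContinuousOn C (Ici 0)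
  A_zero : A 0 = 0
  C_zero : C 0 = 0

/-- `U` is a continuous solution in `[0, L] × [0, ∞)` of `(∂_t + λ ∂_x) U = F(x, t, U)`,
`U|_{t=0} = A`, `U|_{x=0} = C ∫₀ᴸ B U dx`. -/
structure IsStripSolution (L : ℝ) (lam : ℝ → ℝ → ℝ) (F : ℝ → ℝ → E → E) (A : ℝ → E)
    (B C : ℝ → E →L[ℝ] E) (U : ℝ → ℝ → E) : Prop where
  cont : ContinuousOn (fun z : ℝ × ℝ => U z.1 z.2) (Icc 0 L ×ˢ Ici 0)
  eqn : ∀ x ∈ Ioo 0 L, ∀ t ∈ Ioi (0 : ℝ), ∀ ξ : ℝ → ℝ, ξ t = x →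
    (∀ᶠ τ in 𝓝 t, HasDerivAt ξ (lam (ξ τ) τ) τ) →
    HasDerivAt (fun τ => U (ξ τ) τ) (F x t (U x t)) t
  init : ∀ x ∈ Ioo 0 L, U x 0 = A x
  bdry : ∀ t ∈ Ioi (0 : ℝ), U 0 t = C t (∫ s in (0 : ℝ)..L, B s (U s t))

section Strip

variable {L : ℝ} {lam : ℝ → ℝ → ℝ} {F : ℝ → ℝ → E → E} {A : ℝ → E} {B C : ℝ → E →L[ℝ] E}

theorem IsStripSolution.isRectSolution {U : ℝ → ℝ → E} (h : IsStripSolution L lam F A B C U)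
    (T : ℝ) : IsRectSolution L T lam F A B C U where
  cont := h.cont.mono (rect_subset_strip L T)
  eqn x hx t ht := h.eqn x hx t ht.1
  init := h.init
  bdry t ht := h.bdry t ht.1

theorem isStripSolution_of_isRectSolution {U : ℝ → ℝ → E}
    (h : ∀ T > 0, IsRectSolution L T lam F A B C U) : IsStripSolution L lam F A B C U where
  cont := by
    rintro ⟨x, t⟩ ⟨hx, ht⟩
    have ht' : (0 : ℝ) ≤ t := ht
    refine ((h (t + 1) (by linarith)).cont (x, t)
      ⟨hx, ht', by dsimp only; linarith⟩).mono_of_mem_nhdsWithin ?_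
    have : ∀ᶠ z : ℝ × ℝ in 𝓝 (x, t), z.2 < t + 1 :=
      continuous_snd.continuousAt.eventually (gt_mem_nhds (lt_add_one t))
    filter_upwards [self_mem_nhdsWithin, mem_nhdsWithin_of_mem_nhds this] with z hz hz'
    exact ⟨hz.1, hz.2, le_of_lt hz'⟩
  eqn x hx t ht := (h (t + 1) (by linarith [mem_Ioi.1 ht])).eqn x hx t ⟨ht, lt_add_one t⟩
  init := (h 1 one_pos).init
  bdry t ht := (h t ht).bdry t ⟨ht, le_rfl⟩

theorem max_zero_min_mem {T : ℝ} (hT : 0 ≤ T) (t : ℝ) : max 0 (min T t) ∈ Icc 0 T :=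
  ⟨le_max_left _ _, max_le hT (min_le_left _ _)⟩

theorem max_zero_min_of_mem {T t : ℝ} (ht : t ∈ Icc 0 T) : max 0 (min T t) = t := by
  rw [min_eq_right ht.2, max_eq_right ht.1]

theorem max_zero_min_of_nonpos {T t : ℝ} (ht : t ≤ 0) : max 0 (min T t) = 0 :=
  max_eq_left ((min_le_right _ _).trans ht)

theorem IsStripData.exists_unique_isRectSolution [CompleteSpace E]
    (h : IsStripData L lam F A B C) (hL : 0 < L) {T : ℝ} (hT : 0 ≤ T) :
    ∃ U, IsRectSolution L T lam F A B C U ∧ ∀ U', IsRectSolution L T lam F A B C U' →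
      ∀ x ∈ Icc 0 L, ∀ t ∈ Icc 0 T, U' x t = U x t := by
  obtain ⟨K, μ, Λ, hv⟩ := exists_isUniformSpeed hL.le hT
    (h.speed.mono (rect_subset_strip L T)) fun x hx t ht => h.speed_pos x hx t ht.1
  obtain ⟨k, hk, hlip⟩ := h.lip_F T
  have hCT : ContinuousOn C (Icc 0 T) := h.cont_C.mono Icc_subset_Ici_self
  obtain ⟨β, hβ⟩ := isCompact_Icc.exists_bound_of_continuousOn h.cont_B
  obtain ⟨γ, hγ⟩ := isCompact_Icc.exists_bound_of_continuousOn hCT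
  have hmem (x t : ℝ) := rectProj_mem hL.le hT (x, t)
  have hd : IsUniformData
      (fun x t => F (rectProj L T (x, t)).1 (rectProj L T (x, t)).2)
      (fun x => A (max 0 (min L x))) (fun x => B (max 0 (min L x)))
      (fun t => C (max 0 (min T t))) k β γ := by
    refine ⟨?_, fun x t => hlip _ (hmem x t).1 _ (hmem x t).2, ?_, ?_, ?_,
      fun x => hβ _ (max_zero_min_mem hL.le x), fun t => hγ _ (max_zero_min_mem hT t),
      fun x hx => ?_, fun t ht => ?_⟩
    · exact h.cont_F.comp_continuous (f := fun q : (ℝ × ℝ) × E => (rectProj L T q.1, q.2))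
        (((continuous_rectProj L T).comp continuous_fst).prodMk continuous_snd)
        fun q => ⟨rect_subset_strip L T (rectProj_mem hL.le hT q.1), trivial⟩
    · exact h.cont_A.comp_continuous (by fun_prop) (max_zero_min_mem hL.le)
    · exact h.cont_B.comp_continuous (by fun_prop) (max_zero_min_mem hL.le)
    · exact hCT.comp_continuous (by fun_prop) (max_zero_min_mem hT)
    · rw [max_zero_min_of_nonpos hx, h.A_zero]
    · rw [max_zero_min_of_nonpos ht, h.C_zero]
  obtain ⟨U, hU, huniq⟩ := exists_unique_isRectSolution_of_uniform hv hd hk hL hT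
  have hproj {x t : ℝ} (hx : x ∈ Icc 0 L) (ht : t ∈ Icc 0 T) : rectProj L T (x, t) = (x, t) :=
    rectProj_of_mem ⟨hx, ht⟩
  refine ⟨U, hU.congr_data hL.le (fun x hx t ht => by rw [hproj hx ht])
    (fun x hx t ht => by rw [hproj hx ht]) (fun x hx => by dsimp only; rw [max_zero_min_of_mem hx])
    (fun x hx => by dsimp only; rw [max_zero_min_of_mem hx])
    (fun t ht => by dsimp only; rw [max_zero_min_of_mem ht]), fun U' hU' => huniq U' ?_⟩
  exact hU'.congr_data hL.le (fun x hx t ht => by rw [hproj hx ht])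
    (fun x hx t ht => by rw [hproj hx ht]) (fun x hx => by rw [max_zero_min_of_mem hx])
    (fun x hx => by rw [max_zero_min_of_mem hx])
    (fun t ht => by rw [max_zero_min_of_mem ht])

theorem IsStripData.exists_unique_isStripSolution [CompleteSpace E]
    (h : IsStripData L lam F A B C) (hL : 0 < L) :
    ∃ U, IsStripSolution L lam F A B C U ∧ ∀ U', IsStripSolution L lam F A B C U' →
      ∀ x ∈ Icc 0 L, ∀ t ∈ Ici (0 : ℝ), U' x t = U x t := by
  choose U hU huniq using fun T : ℝ≥0 => h.exists_unique_isRectSolution hL T.2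
  have hagree {S T : ℝ≥0} (hST : S ≤ T) : ∀ x ∈ Icc 0 L, ∀ t ∈ Icc 0 (S : ℝ), U T x t = U S x t :=
    huniq S _ ((hU T).mono hST)
  -- The value at time `t` comes from the rectangle of height exactly `t`; by uniqueness it agrees
  -- with every taller rectangle.
  refine ⟨fun x t => U t.toNNReal x t, isStripSolution_of_isRectSolution fun T hT => ?_,
    fun U' hU' x hx t ht => ?_⟩
  · refine (hU ⟨T, hT.le⟩).congr_sol hL.le hT.le fun x hx t ht => ?_
    refine (hagree (S := t.toNNReal) (T := ⟨T, hT.le⟩) (Real.toNNReal_le_iff_le_coe.2 ht.2) x hx t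
      ⟨ht.1, Real.le_coe_toNNReal t⟩).symm
  · exact huniq t.toNNReal U' (hU'.isRectSolution _) x hx t ⟨ht, Real.le_coe_toNNReal t⟩

end Strip

end Transport

/-! ### Mollified delta functions -/

section Regularization

variable {n : ℕ} {y : Fin n → ℝ} {φ : ℝ → ℝ} {ε : ℝ}

theorem regularization_diracSum (y : Fin n → ℝ) (φ : ℝ → ℝ) (ε x : ℝ) :
    regularization (diracSum y) φ ε x = ∑ i, deltaNet φ ε (x - y i) := by
  rw [regularization, diracSum,
    integral_finsetSum_measure fun i _ => integrable_dirac (by simp)]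
  simp only [integral_dirac]

theorem IsMollifier.continuous_regularization (hφ : IsMollifier φ) (y : Fin n → ℝ) (ε : ℝ) :
    Continuous (regularization (diracSum y) φ ε) := by
  have hc := hφ.smooth.continuous
  simp only [funext (regularization_diracSum y φ ε), deltaNet]
  fun_prop

/-- Each `-y i / ε` is below `-1`, hence outside the support of `φ`. This supplies the compatibility
of the data at the corner. -/
theorem IsMollifier.regularization_zero (hφ : IsMollifier φ) (hε : 0 < ε) (hy : ∀ i, ε < y i) :
    regularization (diracSum y) φ ε 0 = 0 := by
  rw [regularization_diracSum]
  refine Finset.sum_eq_zero fun i _ => ?_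
  have hmem : (0 - y i) / ε ∉ tsupport φ := by
    intro hmem
    have h1 := (hφ.supp hmem).1
    rw [le_div_iff₀ hε] at h1
    linarith [hy i]
  rw [deltaNet, image_eq_zero_of_notMem_tsupport hmem, mul_zero]

end Regularization

/-! ### The scalar problem in abstract form -/

section Scalar

variable {L : ℝ} {lam p : ℝ → ℝ → ℝ} {f : ℝ → ℝ → ℝ → ℝ}

theorem exists_bound_rect (hp : ContinuousOn (fun z : ℝ × ℝ => p z.1 z.2) (Icc 0 L ×ˢ Ici 0))
    (T : ℝ) : ∃ k, 0 ≤ k ∧ ∀ x ∈ Icc 0 L, ∀ t ∈ Icc 0 T, |p x t| ≤ k := by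
  obtain ⟨k, hk⟩ := (isCompact_Icc.prod isCompact_Icc).exists_bound_of_continuousOn
    (hp.mono (rect_subset_strip L T))
  exact ⟨max k 0, le_max_right _ _, fun x hx t ht => (hk (x, t) ⟨hx, ht⟩).trans (le_max_left _ _)⟩

theorem exists_lipschitz_rect
    (hf_diff : ∀ x t, (x, t) ∈ Icc (0 : ℝ) L ×ˢ Ici (0 : ℝ) → ContDiff ℝ 1 (fun y => f x t y))
    (hf_bdd : ∀ K : Set (ℝ × ℝ), IsCompact K → K ⊆ Icc (0 : ℝ) L ×ˢ Ici (0 : ℝ) →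
      ∃ C : ℝ, ∀ x t, (x, t) ∈ K → ∀ y, |f x t y| ≤ C ∧ |deriv (fun z => f x t z) y| ≤ C)
    (T : ℝ) : ∃ k, 0 ≤ k ∧ ∀ x ∈ Icc 0 L, ∀ t ∈ Icc 0 T, ∀ y z,
      |f x t y - f x t z| ≤ k * |y - z| := by
  obtain ⟨k, hk⟩ := hf_bdd _ (isCompact_Icc.prod isCompact_Icc) (rect_subset_strip L T)
  refine ⟨max k 0, le_max_right _ _, fun x hx t ht y z => ?_⟩
  exact convex_univ.norm_image_sub_le_of_norm_deriv_le
    (fun w _ => ((hf_diff x t ⟨hx, ht.1⟩).differentiable one_ne_zero) w)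
    (fun w _ => ((hk x t ⟨hx, ht⟩ w).2.trans (le_max_left _ _))) (mem_univ z) (mem_univ y)

theorem abs_linear_add_sub_le {a c kp kf : ℝ} {g : ℝ → ℝ} {y z : ℝ} (ha : |a| ≤ kp)
    (hg : |g y - g z| ≤ kf * |y - z|) (hc : |y - z| ≤ c) (hkf : 0 ≤ kf) :
    |(a * y + g y) - (a * z + g z)| ≤ (kp + kf) * c := by
  have hkp : 0 ≤ kp := (abs_nonneg a).trans ha
  calc |(a * y + g y) - (a * z + g z)| = |a * (y - z) + (g y - g z)| := by ring_nf
    _ ≤ |a| * |y - z| + |g y - g z| := (abs_add_le _ _).trans_eq (by rw [abs_mul])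
    _ ≤ kp * |y - z| + kf * |y - z| := by gcongr
    _ ≤ (kp + kf) * c := by rw [← add_mul]; gcongr

theorem isContSolution_iff_isStripSolution (hL : 0 < L) {a b c : ℝ → ℝ} {u : ℝ → ℝ → ℝ} :
    IsContSolution L lam p f a b c u ↔ IsStripSolution L lam (fun x t y => p x t * y + f x t y) a
      (fun x => b x • ContinuousLinearMap.id ℝ ℝ) (fun t => c t • ContinuousLinearMap.id ℝ ℝ) u := by
  constructor
  · rintro ⟨h1, h2, h3, h4⟩
    rw [closure_halfStrip hL] at h1
    exact ⟨h1, fun x hx t ht => h2 x t ⟨hx.1, hx.2, ht⟩, h3, fun t ht => by simpa using h4 t ht⟩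
  · rintro ⟨h1, h2, h3, h4⟩
    rw [← closure_halfStrip hL] at h1
    exact ⟨h1, fun x t hxt => h2 x ⟨hxt.1, hxt.2.1⟩ t hxt.2.2, h3,
      fun t ht => by simpa using h4 t ht⟩

end Scalar

/-! ### The coupled system in abstract form -/

/-- The operator `(w, v) ↦ ((b_s + b_r) w + b_r v, b_s v)` of the coupled boundary condition. -/
noncomputable def splitKernel (bs br : ℝ → ℝ) (x : ℝ) : ℝ × ℝ →L[ℝ] ℝ × ℝ :=
  ((bs x + br x) • ContinuousLinearMap.fst ℝ ℝ ℝ + br x • ContinuousLinearMap.snd ℝ ℝ ℝ).prod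
    (bs x • ContinuousLinearMap.snd ℝ ℝ ℝ)

/-- The operator `(I, J) ↦ (c_r I, c_s I + c_r J)` of the coupled boundary condition. -/
noncomputable def splitTrace (cs cr : ℝ → ℝ) (t : ℝ) : ℝ × ℝ →L[ℝ] ℝ × ℝ :=
  (cr t • ContinuousLinearMap.fst ℝ ℝ ℝ).prod
    (cs t • ContinuousLinearMap.fst ℝ ℝ ℝ + cr t • ContinuousLinearMap.snd ℝ ℝ ℝ)

theorem continuousOn_clm_prod {X : Type*} [TopologicalSpace X] {s : Set X}
    {g h : X → ℝ × ℝ →L[ℝ] ℝ} (hg : ContinuousOn g s) (hh : ContinuousOn h s) :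
    ContinuousOn (fun x => (g x).prod (h x)) s := by
  have heq : (fun x => (g x).prod (h x)) = fun x =>
      (ContinuousLinearMap.inl ℝ ℝ ℝ).comp (g x) + (ContinuousLinearMap.inr ℝ ℝ ℝ).comp (h x) := by
    funext x
    ext <;> simp
  rw [heq]
  exact (continuousOn_const.clm_comp hg).add (continuousOn_const.clm_comp hh)

theorem isSplitSolution_iff_isStripSolution {L : ℝ} (hL : 0 < L) {lam p : ℝ → ℝ → ℝ}
    {f : ℝ → ℝ → ℝ → ℝ} {as ar bs br cs cr : ℝ → ℝ} (hbs : ContinuousOn bs (Icc 0 L))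
    (hbr : ContinuousOn br (Icc 0 L)) {U : ℝ → ℝ → ℝ × ℝ} :
    IsSplitSolution L lam p f as ar bs br cs cr (fun x t => (U x t).1) (fun x t => (U x t).2) ↔
      IsStripSolution L lam (fun x t y => (p x t * y.1 + f x t y.1, p x t * y.2))
        (fun x => (ar x, as x)) (splitKernel bs br) (splitTrace cs cr) U := by
  have hint (hU : ContinuousOn (fun z : ℝ × ℝ => U z.1 z.2) (Icc 0 L ×ˢ Ici 0)) (t : ℝ)
      (ht : t ∈ Ioi (0 : ℝ)) : splitTrace cs cr t (∫ s in (0 : ℝ)..L, splitKernel bs br s (U s t)) =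
      (cr t * ∫ x in (0 : ℝ)..L, ((bs x + br x) * (U x t).1 + br x * (U x t).2),
        cs t * (∫ x in (0 : ℝ)..L, ((bs x + br x) * (U x t).1 + br x * (U x t).2))
          + cr t * ∫ x in (0 : ℝ)..L, bs x * (U x t).2) := by
    have hUt : ContinuousOn (fun x => U x t) (Icc 0 L) :=
      hU.comp (by fun_prop : Continuous fun x : ℝ => (x, t)).continuousOn
        fun x hx => ⟨hx, mem_Ici.2 (le_of_lt (mem_Ioi.1 ht))⟩
    have hker : ContinuousOn (fun s => splitKernel bs br s (U s t)) (Icc 0 L) := by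
      have : (fun s => splitKernel bs br s (U s t)) = fun s =>
          ((bs s + br s) * (U s t).1 + br s * (U s t).2, bs s * (U s t).2) := by
        funext s
        simp [splitKernel]
      rw [this]
      fun_prop
    have hi : IntervalIntegrable (fun s => splitKernel bs br s (U s t)) volume 0 L :=
      hker.intervalIntegrable_of_Icc hL.le
    have h1 := (ContinuousLinearMap.fst ℝ ℝ ℝ).intervalIntegral_comp_comm hi
    have h2 := (ContinuousLinearMap.snd ℝ ℝ ℝ).intervalIntegral_comp_comm hi
    simp only [splitKernel, ContinuousLinearMap.prod_apply, ContinuousLinearMap.coe_fst',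
      ContinuousLinearMap.coe_snd', add_apply, smul_apply, smul_eq_mul] at h1 h2
    ext <;> simp [splitTrace, splitKernel, h1, h2]
  constructor
  · rintro ⟨h1, h2, h3, h4, h5, h6, h7, h8⟩
    rw [closure_halfStrip hL] at h1 h5
    have hU : ContinuousOn (fun z : ℝ × ℝ => U z.1 z.2) (Icc 0 L ×ˢ Ici 0) := h1.prodMk h5
    refine ⟨hU, fun x hx t ht ξ hξ hder => ?_, fun x hx => Prod.ext (h3 x hx) (h7 x hx),
      fun t ht => ?_⟩
    · exact (h2 x t ⟨hx.1, hx.2, ht⟩ ξ hξ hder).prodMk (h6 x t ⟨hx.1, hx.2, ht⟩ ξ hξ hder)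
    · rw [hint hU t ht]
      exact Prod.ext (h4 t ht) (h8 t ht)
  · rintro ⟨hU, h2, h3, h4⟩
    refine ⟨?_, fun x t hxt ξ hξ hder => ?_, fun x hx => congrArg Prod.fst (h3 x hx),
      fun t ht => ?_, ?_, fun x t hxt ξ hξ hder => ?_, fun x hx => congrArg Prod.snd (h3 x hx),
      fun t ht => ?_⟩
    · rw [closure_halfStrip hL]
      exact hU.fst
    · exact (h2 x ⟨hxt.1, hxt.2.1⟩ t hxt.2.2 ξ hξ hder).fst
    · exact congrArg Prod.fst ((h4 t ht).trans (hint hU t ht))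
    · rw [closure_halfStrip hL]
      exact hU.snd
    · exact (h2 x ⟨hxt.1, hxt.2.1⟩ t hxt.2.2 ξ hξ hder).snd
    · exact congrArg Prod.snd ((h4 t ht).trans (hint hU t ht))

/-! ### Both claims from the abstract theorem -/

theorem proposition1
    (L : ℝ) (hL : 0 < L)
    -- coefficients and nonlinearity
    (lam p : ℝ → ℝ → ℝ) (f : ℝ → ℝ → ℝ → ℝ)
    (hlam : ContDiffOn ℝ 1 (fun z : ℝ × ℝ => lam z.1 z.2) (closure (halfStrip L)))
    (hlam_pos : ∀ x t, (x, t) ∈ closure (halfStrip L) → 0 < lam x t)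
    (hp : ContinuousOn (fun z : ℝ × ℝ => p z.1 z.2) (closure (halfStrip L)))
    (hf : ContinuousOn (fun q : (ℝ × ℝ) × ℝ => f q.1.1 q.1.2 q.2)
      (closure (halfStrip L) ×ˢ univ))
    (hf_diff : ∀ x t, (x, t) ∈ closure (halfStrip L) → ContDiff ℝ 1 (fun y => f x t y))
    (hf_bdd : ∀ K : Set (ℝ × ℝ), IsCompact K → K ⊆ closure (halfStrip L) →
      ∃ C : ℝ, ∀ x t, (x, t) ∈ K → ∀ y, |f x t y| ≤ C ∧ |deriv (fun z => f x t z) y| ≤ C)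
    -- regular parts of the data
    (ar br cr : ℝ → ℝ)
    (har : ContinuousOn ar (Icc 0 L)) (hbr : ContinuousOn br (Icc 0 L))
    (hcr : ContinuousOn cr (Ici 0))
    (har0 : ar 0 = 0) (hcr0 : cr 0 = 0)
    -- supports of the singular parts of the data
    (m k l : ℕ) (xs : Fin m → ℝ) (xb : Fin k → ℝ) (tc : Fin l → ℝ)
    (hxs : StrictMono xs) (hxs_mem : ∀ i, xs i ∈ Ioo 0 L)
    (hxb : StrictMono xb) (hxb_mem : ∀ i, xb i ∈ Ioo 0 L)
    (htc : StrictMono tc) (htc_pos : ∀ j, 0 < tc j)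
    -- mollifier and range of the regularization parameter
    (φ : ℝ → ℝ) (hφ : IsMollifier φ)
    (ε₀ : ℝ) (hε₀xs : ∀ i, ε₀ < xs i) (hε₀tc : ∀ j, ε₀ < tc j)
    (ε : ℝ) (hε : 0 < ε) (hεε₀ : ε ≤ ε₀) :
    (∃ u : ℝ → ℝ → ℝ,
      IsContSolution L lam p f
        (fun x => regularization (diracSum xs) φ ε x + ar x)
        (fun x => regularization (diracSum xb) φ ε x + br x)
        (fun t => regularization (diracSum tc) φ ε t + cr t) u ∧
      ∀ u' : ℝ → ℝ → ℝ,
        IsContSolution L lam p f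
          (fun x => regularization (diracSum xs) φ ε x + ar x)
          (fun x => regularization (diracSum xb) φ ε x + br x)
          (fun t => regularization (diracSum tc) φ ε t + cr t) u' →
        ∀ x t, (x, t) ∈ closure (halfStrip L) → u' x t = u x t) ∧
    (∃ w v : ℝ → ℝ → ℝ,
      IsSplitSolution L lam p f
        (regularization (diracSum xs) φ ε) ar
        (regularization (diracSum xb) φ ε) br
        (regularization (diracSum tc) φ ε) cr w v ∧
      ∀ w' v' : ℝ → ℝ → ℝ,
        IsSplitSolution L lam p f
          (regularization (diracSum xs) φ ε) ar
          (regularization (diracSum xb) φ ε) br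
          (regularization (diracSum tc) φ ε) cr w' v' →
        ∀ x t, (x, t) ∈ closure (halfStrip L) → w' x t = w x t ∧ v' x t = v x t) := by
  have hS := closure_halfStrip hL
  rw [hS] at hlam hp hf
  simp only [hS] at hlam_pos hf_diff hf_bdd
  have hreg {n : ℕ} (y : Fin n → ℝ) := hφ.continuous_regularization y ε
  have has0 := hφ.regularization_zero hε fun i => hεε₀.trans_lt (hε₀xs i)
  have hcs0 := hφ.regularization_zero hε fun j => hεε₀.trans_lt (hε₀tc j)
  have hp' : ContinuousOn (fun q : (ℝ × ℝ) × ℝ => p q.1.1 q.1.2)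
      ((Icc 0 L ×ˢ Ici 0) ×ˢ univ) := hp.comp continuousOn_fst fun q hq => hq.1
  -- The free bound `c` serves both parts: `|y - z|` itself in the scalar case, the sup norm of the
  -- difference of pairs in the coupled one.
  have hlip (T : ℝ) : ∃ k, 0 ≤ k ∧ ∀ x ∈ Icc 0 L, ∀ t ∈ Icc 0 T, |p x t| ≤ k ∧
      ∀ y z c, |y - z| ≤ c → |(p x t * y + f x t y) - (p x t * z + f x t z)| ≤ k * c := by
    obtain ⟨kp, hkp0, hkp⟩ := exists_bound_rect hp T
    obtain ⟨kf, hkf0, hkf⟩ := exists_lipschitz_rect hf_diff hf_bdd T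
    exact ⟨kp + kf, by positivity, fun x hx t ht =>
      ⟨(hkp x hx t ht).trans (by linarith), fun y z c hc =>
        abs_linear_add_sub_le (hkp x hx t ht) (hkf x hx t ht y z) hc hkf0⟩⟩
  constructor
  · have hdata : IsStripData L lam (fun x t y => p x t * y + f x t y)
        (fun x => regularization (diracSum xs) φ ε x + ar x)
        (fun x => (regularization (diracSum xb) φ ε x + br x) • ContinuousLinearMap.id ℝ ℝ)
        (fun t => (regularization (diracSum tc) φ ε t + cr t) • ContinuousLinearMap.id ℝ ℝ) := by
      refine ⟨hlam, fun x hx t ht => hlam_pos x t ⟨hx, ht⟩, (hp'.mul continuousOn_snd).add hf,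
        fun T => ?_, (hreg xs).continuousOn.add har,
        ((hreg xb).continuousOn.add hbr).smul continuousOn_const,
        ((hreg tc).continuousOn.add hcr).smul continuousOn_const, ?_, ?_⟩
      · obtain ⟨k, hk, h⟩ := hlip T
        exact ⟨k, hk, fun x hx t ht y z => (h x hx t ht).2 y z _ le_rfl⟩
      · simp only [has0, har0, add_zero]
      · simp only [hcs0, hcr0, add_zero, zero_smul]
    obtain ⟨u, hu, huniq⟩ := hdata.exists_unique_isStripSolution hL
    refine ⟨u, (isContSolution_iff_isStripSolution hL).2 hu, fun u' hu' x t hxt => ?_⟩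
    rw [hS] at hxt
    exact huniq u' ((isContSolution_iff_isStripSolution hL).1 hu') x hxt.1 t hxt.2
  · have hdata : IsStripData L lam (fun x t (y : ℝ × ℝ) => (p x t * y.1 + f x t y.1, p x t * y.2))
        (fun x => (ar x, regularization (diracSum xs) φ ε x))
        (splitKernel (regularization (diracSum xb) φ ε) br)
        (splitTrace (regularization (diracSum tc) φ ε) cr) := by
      have hbs := (hreg xb).continuousOn (s := Icc 0 L)
      have hcs := (hreg tc).continuousOn (s := Ici 0)
      refine ⟨hlam, fun x hx t ht => hlam_pos x t ⟨hx, ht⟩, ?_, fun T => ?_,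
        har.prodMk (hreg xs).continuousOn, ?_, ?_, ?_, ?_⟩
      · have h1 : ContinuousOn (fun q : (ℝ × ℝ) × (ℝ × ℝ) => p q.1.1 q.1.2)
            ((Icc 0 L ×ˢ Ici 0) ×ˢ univ) := hp.comp continuousOn_fst fun q hq => hq.1
        have h2 : ContinuousOn (fun q : (ℝ × ℝ) × (ℝ × ℝ) => f q.1.1 q.1.2 q.2.1)
            ((Icc 0 L ×ˢ Ici 0) ×ˢ univ) :=
          hf.comp (by fun_prop : Continuous fun q : (ℝ × ℝ) × (ℝ × ℝ) => (q.1, q.2.1)).continuousOn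
            fun q hq => ⟨hq.1, trivial⟩
        exact ((h1.mul continuousOn_snd.fst).add h2).prodMk (h1.mul continuousOn_snd.snd)
      · obtain ⟨k, hk, h⟩ := hlip T
        refine ⟨k, hk, fun x hx t ht y z => max_le ?_ ?_⟩
        · exact (h x hx t ht).2 _ _ _ (norm_fst_le (y - z))
        · rw [Prod.snd_sub, ← mul_sub, norm_mul]
          exact mul_le_mul (h x hx t ht).1 (norm_snd_le (y - z)) (norm_nonneg _) hk
      · exact continuousOn_clm_prod (((hbs.add hbr).smul continuousOn_const).add
          (hbr.smul continuousOn_const)) (hbs.smul continuousOn_const)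
      · exact continuousOn_clm_prod (hcr.smul continuousOn_const)
          ((hcs.smul continuousOn_const).add (hcr.smul continuousOn_const))
      · simp only [har0, has0, Prod.mk_zero_zero]
      · ext <;> simp [splitTrace, hcr0, hcs0]
    obtain ⟨U, hU, huniq⟩ := hdata.exists_unique_isStripSolution hL
    have hbs := (hreg xb).continuousOn (s := Icc 0 L)
    refine ⟨_, _, (isSplitSolution_iff_isStripSolution hL hbs hbr).2 hU,
      fun w' v' hwv x t hxt => ?_⟩
    rw [hS] at hxt
    have := huniq (fun x t => (w' x t, v' x t))
      ((isSplitSolution_iff_isStripSolution hL hbs hbr).1 hwv) x hxt.1 t hxt.2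
    exact ⟨congrArg Prod.fst this, congrArg Prod.snd this⟩
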